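/- A bounded measurable set $S\subset\mathbb{R}^d$ of non-zero Lebesgue measure is called spectral if there is a collection of (continuous, unitary) characters of $\mathbb{R}^d$, that is, of functions $x\mapsto e^{2\pi i\langle\lambda,x\rangle}$ with $\lambda\in\mathbb{R}^d$, whose restrictions to $S$ form an orthogonal basis of $L^2(S)$. Theorem. There exist bounded measurable sets $A,B\subset\mathbb{R}^3$ of non-zero Lebesgue measure such that $A$ is not spectral but the Cartesian product $A\times B\subset\mathbb{R}^6$ is spectral. -/

import Mathlib

open MeasureTheory

/-- `IsSpectrum S Λ`: `Λ` is a set of (continuous, unitary) characters of the additive group `ℝᵈ`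
whose restrictions to `S` form an orthogonal basis of the Hilbert space `L²(S)`:
they are pairwise orthogonal and their linear span is dense. Here `e χ` is the class in `L²(S)`
of the restriction of `χ`. (When `S` has positive measure, no `e χ` vanishes, as `|χ| = 1`.) -/
def IsSpectrum {d : ℕ} (S : Set (EuclideanSpace ℝ (Fin d)))
    (Λ : Set (AddChar (EuclideanSpace ℝ (Fin d)) Circle)) : Prop :=
  (∀ χ ∈ Λ, Continuous χ) ∧
  ∃ e : Λ → Lp ℂ 2 (volume.restrict S),
    (∀ χ : Λ, e χ =ᵐ[volume.restrict S] fun x => (χ.1 x : ℂ)) ∧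
    (Pairwise fun χ ψ : Λ => inner ℂ (e χ) (e ψ) = 0) ∧
    (Submodule.span ℂ (Set.range e)).topologicalClosure = ⊤

/-- A bounded measurable set of non-zero measure in `ℝᵈ` is spectral if some collection of
characters of `ℝᵈ` restricts to an orthogonal basis of `L²(S)`. -/
def IsSpectral {d : ℕ} (S : Set (EuclideanSpace ℝ (Fin d))) : Prop :=
  Bornology.IsBounded S ∧ MeasurableSet S ∧ volume S ≠ 0 ∧ ∃ Λ, IsSpectrum S Λ

/-- The Cartesian product `A × B ⊆ ℝᵐ⁺ⁿ` of `A ⊆ ℝᵐ` and `B ⊆ ℝⁿ`: the points whose first `m`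
coordinates form a point of `A` and whose last `n` coordinates form a point of `B`. -/
def cartesianProduct {m n : ℕ} (A : Set (EuclideanSpace ℝ (Fin m)))
    (B : Set (EuclideanSpace ℝ (Fin n))) : Set (EuclideanSpace ℝ (Fin (m + n))) :=
  {z | WithLp.toLp 2 (fun i : Fin m => z (Fin.castAdd n i)) ∈ A ∧
       WithLp.toLp 2 (fun j : Fin n => z (Fin.natAdd m j)) ∈ B}

/-! If a finite F ⊂ ℤᵈ tiles ℤᵈ modulo M with translations T, let A and B be the unions of unit
cubes over F and T. Then A × B is a fundamental domain of a lattice, which becomes ℤ²ᵈ in the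
coordinates ((x + y) / M, y) (`isSpectral_cartesianProduct_cubeUnion`). A fundamental domain of a
lattice is spectral: it is a copy of the torus, and the Fourier monomials give the spectrum
(`exists_isSpectrum_of_lattice_tile`). What remains is a tile F for which A is not spectral.

The obstruction is a weighted density count (`IsSpectrum.volume_mul_lintegral_le`). Let F be the
part in a box of side M of a periodic set 𝒜 of density at least 1/|S|, where S ⊂ (ℤ/q)ᵈ and the
Fourier coefficients of 𝒜 at k/q are nonzero for k ∈ S - S. For M large, the transform of A has no
zero close to such k/q in the relevant range, whereas distinct frequencies of a spectrum differ by
zeros. Place a box of side 1/M at each of the qᵈ points of q⁻¹ℤᵈ in the unit cube. The boxes hit by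
a translate of the spectrum then have labels forming a packing with S, so there are at most ⌊qᵈ/|S|⌋
hits; the density count demands at least qᵈ/|S|. This is absurd if |S| does not divide qᵈ
(`exists_not_isSpectrum_cubeUnion`).

Here q = 8, d = 3, |S| = 6. The set `periodicTile` is cut into layers by the third coordinate modulo
11. A layer is given by a linear form modulo 8 with values in a half arc and a linear form modulo 3
equal to 0, and the same six translations tile every layer. All layers contribute a nonnegative real
part to the coefficient at k/8, and a layer contributes a positive one if k is zero or an odd
multiple of its form; every element of S - S is so related to some layer
(`expSum_periodicTile_ne_zero`). -/

/-! ### Continuous characters of ℝᵈ -/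

theorem AddChar.exists_eq_fourierChar_of_continuous (χ : AddChar ℝ Circle) (hχ : Continuous χ) :
    ∃ a : ℝ, ∀ x, χ x = Real.fourierChar (a * x) := by
  have hc : Continuous fun x => (χ x : ℂ) := continuous_subtype_val.comp hχ
  have hF : ∀ x, HasDerivAt (fun u => ∫ t in (0 : ℝ)..u, (χ t : ℂ)) (χ x : ℂ) x := fun x =>
    intervalIntegral.integral_hasDerivAt_right (hc.intervalIntegrable _ _)
      (hc.stronglyMeasurableAtFilter _ _) hc.continuousAt
  set F : ℝ → ℂ := fun u => ∫ t in (0 : ℝ)..u, (χ t : ℂ) with hFdef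
  obtain ⟨c, hc0⟩ : ∃ c, F c ≠ 0 := by
    by_contra! h
    have h1 := hF 0
    rw [show F = fun _ => (0 : ℂ) from funext h] at h1
    simpa using h1.unique (hasDerivAt_const 0 (0 : ℂ))
  -- Integrating χ (x + t) = χ x χ t over t ∈ [0, c] expresses χ through its primitive. So χ is
  -- differentiable and solves χ' = zχ.
  have hshift : ∀ x, (χ x : ℂ) = (F (x + c) - F x) / F c := by
    intro x
    rw [eq_div_iff hc0, hFdef]
    simp only
    rw [intervalIntegral.integral_interval_sub_left (hc.intervalIntegrable _ _)
      (hc.intervalIntegrable _ _), ← intervalIntegral.integral_const_mul]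
    have := intervalIntegral.integral_comp_add_left (a := 0) (b := c) (fun t => (χ t : ℂ)) x
    simp only [add_zero] at this
    rw [← this]
    simp [AddChar.map_add_eq_mul]
  obtain ⟨z, hz⟩ : ∃ z : ℂ, HasDerivAt (fun x => (χ x : ℂ)) z 0 := by
    refine ⟨(χ (0 + c) - χ 0) / F c, ?_⟩
    rw [show (fun x => (χ x : ℂ)) = fun x => (F (x + c) - F x) / F c from funext hshift]
    exact (((hF (0 + c)).comp_add_const 0 c).sub (hF 0)).div_const _
  have hd : ∀ x, HasDerivAt (fun x => (χ x : ℂ)) (χ x * z) x := by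
    intro x
    have h1 : HasDerivAt (fun y => (χ (y - x) : ℂ)) z x := by
      have h0 : HasDerivAt (fun x => (χ x : ℂ)) z (x - x) := by simpa using hz
      exact h0.comp_sub_const x x
    have h2 := h1.const_mul (χ x : ℂ)
    refine h2.congr_of_eventuallyEq (Filter.Eventually.of_forall fun y => ?_)
    simp only
    rw [← Circle.coe_mul, ← AddChar.map_add_eq_mul]
    simp
  have hconst : ∀ x : ℝ, (χ x : ℂ) = Complex.exp (x * z) := by
    have hder : ∀ x : ℝ, HasDerivAt (fun x : ℝ => (χ x : ℂ) * Complex.exp (-(x * z))) 0 x := by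
      intro x
      have h1 : HasDerivAt (fun x : ℝ => Complex.exp (-(x * z))) (Complex.exp (-(x * z)) * -(1 * z)) x :=
        (((hasDerivAt_id x).ofReal_comp.mul_const z).neg).cexp
      have h2 := (hd x).mul h1
      rwa [show (χ x : ℂ) * z * Complex.exp (-(x * z)) +
        χ x * (Complex.exp (-(x * z)) * -(1 * z)) = 0 by ring] at h2
    intro x
    have h := is_const_of_deriv_eq_zero (fun x => (hder x).differentiableAt)
      (fun x => (hder x).deriv) x 0
    simp only [Complex.exp_neg] at h
    rw [mul_inv_eq_iff_eq_mul₀ (Complex.exp_ne_zero _)] at h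
    simpa using h
  have hre : z.re = 0 := by
    have h := congrArg norm (hconst 1)
    rw [Circle.norm_coe, Complex.norm_exp] at h
    simpa using h.symm
  refine ⟨z.im / (2 * Real.pi), fun x => ?_⟩
  apply Circle.ext
  rw [hconst, Real.fourierChar_apply]
  rw [show z = z.im * Complex.I from Complex.ext (by simp [hre]) (by simp)]
  congr 1
  have : (Real.pi : ℂ) ≠ 0 := Complex.ofReal_ne_zero.mpr Real.pi_ne_zero
  push_cast
  simp only [Complex.mul_I_im, Complex.ofReal_re]
  field_simp

/-- The character `x ↦ exp (2πi⟨v, x⟩)` of a Euclidean space. -/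
noncomputable def innerChar {d : ℕ} (v : EuclideanSpace ℝ (Fin d)) :
    AddChar (EuclideanSpace ℝ (Fin d)) Circle :=
  Real.fourierChar.compAddMonoidHom (innerₗ _ v).toAddMonoidHom

theorem innerChar_apply {d : ℕ} (v x : EuclideanSpace ℝ (Fin d)) :
    innerChar v x = Real.fourierChar (inner ℝ v x) := rfl

theorem continuous_innerChar {d : ℕ} (v : EuclideanSpace ℝ (Fin d)) :
    Continuous (innerChar v) := by
  simp only [funext (innerChar_apply v)]
  fun_prop

theorem AddChar.exists_eq_innerChar {d : ℕ} (χ : AddChar (EuclideanSpace ℝ (Fin d)) Circle)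
    (hχ : Continuous χ) : ∃ v, χ = innerChar v := by
  have h : ∀ i : Fin d, ∃ a : ℝ, ∀ x : ℝ,
      χ (x • EuclideanSpace.single i 1) = Real.fourierChar (a * x) := by
    intro i
    refine AddChar.exists_eq_fourierChar_of_continuous
      (χ.compAddMonoidHom ⟨⟨fun x : ℝ => x • EuclideanSpace.single i (1 : ℝ), by simp⟩, ?_⟩) ?_
    · intro x y
      simp [add_smul]
    · exact hχ.comp (by
        show Continuous fun x : ℝ => x • EuclideanSpace.single i (1 : ℝ)
        fun_prop)
  choose a ha using h
  have hsum : ∀ (ψ : AddChar (EuclideanSpace ℝ (Fin d)) Circle)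
      (f : Fin d → EuclideanSpace ℝ (Fin d)), ψ (∑ i, f i) = ∏ i, ψ (f i) := fun ψ f =>
    map_prod ψ.toMonoidHom (fun i => Multiplicative.ofAdd (f i)) Finset.univ
  refine ⟨WithLp.toLp 2 a, ?_⟩
  ext x : 1
  have hx : x = ∑ i, x i • EuclideanSpace.single i (1 : ℝ) := by
    ext j
    simp [Finset.sum_apply, Pi.single_apply]
  conv_lhs => rw [hx]
  conv_rhs => rw [hx]
  rw [hsum, hsum]
  refine Finset.prod_congr rfl fun i _ => ?_
  rw [ha, innerChar_apply]
  simp [inner_smul_right, mul_comm, EuclideanSpace.inner_single_right]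

/-! ### Plancherel for indicator functions -/

section CharIntegral

open scoped FourierTransform SchwartzMap ENNReal

section Plancherel

variable {V : Type*} [NormedAddCommGroup V] [InnerProductSpace ℝ V] [FiniteDimensional ℝ V]
  [MeasurableSpace V] [BorelSpace V]

/-- Both transforms are moved onto a test function: the L² one by its compatibility with tempered
distributions, the integral one by Fubini. -/
theorem MeasureTheory.Lp.fourier_ae_eq_of_integrable
    (f : Lp (α := V) ℂ 2 (volume : Measure V)) (hf : Integrable f) :
    (𝓕 f : Lp (α := V) ℂ 2 (volume : Measure V)) =ᵐ[volume] 𝓕 (f : V → ℂ) := by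
  have hcont : Continuous (𝓕 (f : V → ℂ)) :=
    VectorFourier.fourierIntegral_continuous Real.continuous_fourierChar
      (by exact continuous_inner) hf
  refine ae_eq_of_integral_contDiff_smul_eq
    ((Lp.memLp (μ := volume)
      (𝓕 f : Lp (α := V) ℂ 2 (volume : Measure V))).locallyIntegrable (by norm_num))
    hcont.locallyIntegrable fun g hg hgc => ?_
  have hg' : HasCompactSupport (fun x => (g x : ℂ)) := hgc.comp_left (g := fun t : ℝ => (t : ℂ)) rfl
  let φ : 𝓢(V, ℂ) := hg'.toSchwartzMap (Complex.ofRealCLM.contDiff.comp hg)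
  have h := congrArg (fun T : 𝓢'(V, ℂ) => T φ) (Lp.fourier_toTemperedDistribution_eq f)
  simp only [TemperedDistribution.fourier_apply, Lp.toTemperedDistribution_apply] at h
  have hφ : ∀ x, φ x = (g x : ℂ) := fun x => rfl
  calc ∫ x, g x • (𝓕 f : Lp (α := V) ℂ 2 (volume : Measure V)) x =
      ∫ x, φ x • (𝓕 f : Lp (α := V) ℂ 2 (volume : Measure V)) x := by
        simp only [hφ]; rfl
    _ = ∫ x, 𝓕 (φ : V → ℂ) x • f x := by rw [← h]; rfl
    _ = ∫ x, φ x • 𝓕 (f : V → ℂ) x := by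
        simpa using! VectorFourier.integral_fourierIntegral_smul_eq_flip (L := innerₗ V)
          Real.continuous_fourierChar continuous_inner (φ.integrable (μ := volume)) hf
    _ = _ := by simp only [hφ]; rfl

theorem lintegral_enorm_sq_fourier_indicator {A : Set V} (hA : MeasurableSet A)
    (hA' : volume A ≠ ∞) :
    ∫⁻ ξ, ‖𝓕 (A.indicator fun _ => (1 : ℂ)) ξ‖ₑ ^ 2 = volume A := by
  let f : Lp (α := V) ℂ 2 (volume : Measure V) := indicatorConstLp 2 hA hA' 1
  have hf : f =ᵐ[volume] A.indicator fun _ => (1 : ℂ) := indicatorConstLp_coeFn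
  have hint : Integrable f := integrable_indicatorConstLp hA hA' 1
  have h1 : 𝓕 (f : V → ℂ) = 𝓕 (A.indicator fun _ => (1 : ℂ)) := by
    ext ξ
    rw [Real.fourier_eq, Real.fourier_eq]
    exact integral_congr_ae (hf.mono fun x hx => by simp only [hx])
  have h2 := Lp.fourier_ae_eq_of_integrable f hint
  have h3 : eLpNorm (𝓕 f : Lp (α := V) ℂ 2 (volume : Measure V)) 2 volume = eLpNorm f 2 volume := by
    rw [← Lp.enorm_def, ← Lp.enorm_def, ← ofReal_norm, ← ofReal_norm, Lp.norm_fourier_eq]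
  rw [eLpNorm_congr_ae h2, h1, eLpNorm_congr_ae hf] at h3
  have h4 := congrArg (· ^ (2 : ℝ)) h3
  simp only [eLpNorm_eq_lintegral_rpow_enorm_toReal (p := 2) (by norm_num) (by norm_num),
    ENNReal.toReal_ofNat, ← ENNReal.rpow_mul] at h4
  norm_num at h4
  rw [h4]
  rw [show (fun x => ‖A.indicator (fun _ => (1 : ℂ)) x‖ₑ ^ 2) = A.indicator 1 by
    ext x; by_cases hx : x ∈ A <;> simp [hx]]
  exact lintegral_indicator_one hA

end Plancherel

/-- The integral over `A` of the character with frequency `ξ`. -/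
noncomputable def charIntegral {d : ℕ} (A : Set (EuclideanSpace ℝ (Fin d)))
    (ξ : EuclideanSpace ℝ (Fin d)) : ℂ :=
  ∫ x in A, (innerChar ξ x : ℂ)

theorem charIntegral_eq_fourier {d : ℕ} {A : Set (EuclideanSpace ℝ (Fin d))}
    (hA : MeasurableSet A) (ξ : EuclideanSpace ℝ (Fin d)) :
    charIntegral A ξ = 𝓕 (A.indicator fun _ => (1 : ℂ)) (-ξ) := by
  rw [charIntegral, Real.fourier_eq, ← integral_indicator hA]
  refine integral_congr_ae (.of_forall fun x => ?_)
  by_cases hx : x ∈ A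
  · simp [hx, innerChar_apply, Circle.smul_def, real_inner_comm]
  · simp [hx]

theorem continuous_charIntegral {d : ℕ} {A : Set (EuclideanSpace ℝ (Fin d))}
    (hA : MeasurableSet A) (hA' : volume A ≠ ∞) : Continuous (charIntegral A) := by
  have hint : Integrable (A.indicator fun _ => (1 : ℂ)) :=
    (integrable_indicator_iff hA).mpr (integrableOn_const hA')
  have hcont : Continuous (𝓕 (A.indicator fun _ => (1 : ℂ))) :=
    VectorFourier.fourierIntegral_continuous Real.continuous_fourierChar
      (by exact continuous_inner) hint
  rw [show charIntegral A = _ from funext (charIntegral_eq_fourier hA)]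
  exact hcont.comp continuous_neg

theorem lintegral_enorm_sq_charIntegral {d : ℕ} {A : Set (EuclideanSpace ℝ (Fin d))}
    (hA : MeasurableSet A) (hA' : volume A ≠ ∞) :
    ∫⁻ ξ, ‖charIntegral A ξ‖ₑ ^ 2 = volume A := by
  have hneg := Measure.measurePreserving_neg (volume : Measure (EuclideanSpace ℝ (Fin d)))
  rw [← lintegral_enorm_sq_fourier_indicator (V := EuclideanSpace ℝ (Fin d)) hA hA',
    ← hneg.lintegral_comp_emb (Homeomorph.neg (EuclideanSpace ℝ (Fin d))).measurableEmbedding]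
  simp only [charIntegral_eq_fourier hA, neg_neg]

end CharIntegral

/-! ### Parseval for a spectrum -/

section Frequencies

open scoped ENNReal

variable {d : ℕ} {A : Set (EuclideanSpace ℝ (Fin d))}

theorem coe_innerChar_sub (v w x : EuclideanSpace ℝ (Fin d)) :
    (innerChar (v - w) x : ℂ) = (starRingEnd ℂ) (innerChar w x) * innerChar v x := by
  rw [← Circle.coe_inv_eq_conj, ← Circle.coe_mul, innerChar_apply, innerChar_apply,
    innerChar_apply, ← AddChar.map_neg_eq_inv, ← AddChar.map_add_eq_mul, inner_sub_left]
  congr 2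
  ring

theorem memLp_innerChar (hA' : volume A ≠ ∞) (ξ : EuclideanSpace ℝ (Fin d)) :
    MemLp (fun x => (innerChar ξ x : ℂ)) 2 (volume.restrict A) := by
  have : IsFiniteMeasure (volume.restrict A) := ⟨by simpa using hA'.lt_top⟩
  refine MemLp.of_bound ?_ 1 (.of_forall fun x => (Circle.norm_coe _).le)
  have h := continuous_innerChar ξ
  exact (continuous_subtype_val.comp h).aestronglyMeasurable

theorem charIntegral_zero : charIntegral A 0 = volume.real A := by
  simp [charIntegral, innerChar_apply]

theorem inner_of_ae_eq_innerChar {f g : Lp ℂ 2 (volume.restrict A)}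
    {v w : EuclideanSpace ℝ (Fin d)}
    (hf : f =ᵐ[volume.restrict A] fun x => (innerChar v x : ℂ))
    (hg : g =ᵐ[volume.restrict A] fun x => (innerChar w x : ℂ)) :
    inner ℂ f g = charIntegral A (w - v) := by
  rw [L2.inner_def, charIntegral]
  refine integral_congr_ae ?_
  filter_upwards [hf, hg] with x hx hy
  rw [hx, hy, coe_innerChar_sub, RCLike.inner_apply, mul_comm]

/-- Divided by √|A|, the characters form a Hilbert basis; the last clause is Parseval for the
character of frequency ξ. -/
theorem IsSpectrum.exists_frequencies {Λ : Set (AddChar (EuclideanSpace ℝ (Fin d)) Circle)}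
    (h : IsSpectrum A Λ) (hA0 : volume A ≠ 0) (hA' : volume A ≠ ∞) :
    ∃ v : Λ → EuclideanSpace ℝ (Fin d), Countable Λ ∧
      (∀ χ ψ, χ ≠ ψ → charIntegral A (v χ - v ψ) = 0) ∧
      ∀ ξ, ∑' χ, ‖charIntegral A (ξ - v χ)‖ₑ ^ 2 = volume A ^ 2 := by
  obtain ⟨hcont, e, he, horth, hspan⟩ := h
  choose v hv using fun χ : Λ => AddChar.exists_eq_innerChar χ.1 (hcont _ χ.2)
  have he' : ∀ χ, e χ =ᵐ[volume.restrict A] fun x => (innerChar (v χ) x : ℂ) := fun χ => by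
    simpa only [← hv χ] using he χ
  set V : ℝ := volume.real A with hV
  have hVpos : 0 < V := ENNReal.toReal_pos hA0 hA'
  have hnorm : ∀ f : Lp ℂ 2 (volume.restrict A), ∀ w,
      f =ᵐ[volume.restrict A] (fun x => (innerChar w x : ℂ)) → ‖f‖ = √V := by
    intro f w hf
    have h1 := inner_of_ae_eq_innerChar hf hf
    rw [sub_self, charIntegral_zero, inner_self_eq_norm_sq_to_K] at h1
    rw [eq_comm, Real.sqrt_eq_iff_eq_sq hVpos.le (norm_nonneg _)]
    exact Complex.ofReal_injective (by push_cast; exact h1.symm)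
  have hsq : √V ≠ 0 := (Real.sqrt_pos.mpr hVpos).ne'
  have hon : Orthonormal ℂ fun χ => ((√V)⁻¹ : ℂ) • e χ := by
    refine ⟨fun χ => ?_, fun χ ψ hne => ?_⟩
    · rw [norm_smul, hnorm _ _ (he' χ)]
      simp [abs_of_pos (Real.sqrt_pos.mpr hVpos), hsq]
    · simp only [inner_smul_left, inner_smul_right]
      rw [horth hne]
      simp
  have hsp : ⊤ ≤ (Submodule.span ℂ
      (Set.range fun χ => ((√V)⁻¹ : ℂ) • e χ)).topologicalClosure := by
    rw [← hspan]
    refine Submodule.topologicalClosure_mono (Submodule.span_le.mpr ?_)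
    rintro _ ⟨χ, rfl⟩
    have h1 := Submodule.smul_mem _ (√V : ℂ) (Submodule.subset_span (R := ℂ)
      (Set.mem_range_self (f := fun χ => ((√V)⁻¹ : ℂ) • e χ) χ))
    rwa [smul_smul, mul_inv_cancel₀ (by exact_mod_cast hsq), one_smul] at h1
  let b := HilbertBasis.mk hon hsp
  have hb : ∀ χ, b χ = ((√V)⁻¹ : ℂ) • e χ := fun χ => by rw [HilbertBasis.coe_mk]
  refine ⟨v, ?_, fun χ ψ hne => ?_, fun ξ => ?_⟩
  · have : Fact ((2 : ℝ≥0∞) ≠ ∞) := ⟨by norm_num⟩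
    -- Orthonormal vectors are √2 apart, so balls of radius 1/2 around them are disjoint; L² is
    -- separable.
    have hdist : ∀ χ ψ, χ ≠ ψ → 1 < dist (b χ) (b ψ) := by
      intro χ ψ hne
      have h1 := b.orthonormal.1 χ
      have h2 := b.orthonormal.1 ψ
      have h3 := b.orthonormal.2 hne
      have h4 := @norm_sub_sq ℂ _ _ _ _ (b χ) (b ψ)
      rw [h1, h2, h3] at h4
      norm_num at h4
      rw [dist_eq_norm]
      nlinarith [norm_nonneg (b χ - b ψ)]
    refine Pairwise.countable_of_isOpen_disjoint (s := fun χ => Metric.ball (b χ) (1 / 2)) ?_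
      (fun χ => Metric.isOpen_ball) (fun χ => ⟨b χ, Metric.mem_ball_self (by norm_num)⟩)
    intro χ ψ hne
    refine Metric.ball_disjoint_ball ?_
    have := (hdist χ ψ hne).le
    norm_num
    exact this
  · rw [← inner_of_ae_eq_innerChar (he' ψ) (he' χ)]
    exact horth hne.symm
  · let f := (memLp_innerChar hA' ξ).toLp
    have hf : f =ᵐ[volume.restrict A] fun x => (innerChar ξ x : ℂ) := MemLp.coeFn_toLp _
    have h1 := b.hasSum_inner_mul_inner f f
    have h2 : ∀ χ, inner ℂ f (b χ) * inner ℂ (b χ) f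
        = ((V⁻¹ * ‖charIntegral A (ξ - v χ)‖ ^ 2 : ℝ) : ℂ) := by
      intro χ
      rw [← inner_conj_symm f (b χ), ← Complex.normSq_eq_conj_mul_self,
        Complex.normSq_eq_norm_sq, hb, inner_smul_left, inner_of_ae_eq_innerChar (he' χ) hf]
      congr 1
      rw [norm_mul, mul_pow]
      congr 1
      simp [Real.sq_sqrt hVpos.le]
    have h3 : inner ℂ f f = ((V : ℝ) : ℂ) := by
      rw [inner_of_ae_eq_innerChar hf hf, sub_self, charIntegral_zero]
    simp only [h2, h3] at h1
    have h4 : HasSum (fun χ => V⁻¹ * ‖charIntegral A (ξ - v χ)‖ ^ 2) V := by exact_mod_cast h1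
    have h5 := h4.mul_left V
    simp only [mul_inv_cancel_left₀ hVpos.ne'] at h5
    have h6 : ∀ χ, ‖charIntegral A (ξ - v χ)‖ₑ ^ 2
        = ENNReal.ofReal (‖charIntegral A (ξ - v χ)‖ ^ 2) := fun χ => by
      rw [ENNReal.ofReal_pow (norm_nonneg _), ofReal_norm]
    simp only [h6]
    rw [← ENNReal.ofReal_tsum_of_nonneg (fun _ => by positivity) h5.summable, h5.tsum_eq,
      ENNReal.ofReal_mul hVpos.le, hV, measureReal_def, ENNReal.ofReal_toReal hA', sq]

end Frequencies

/-! ### Density bound for the frequencies -/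

section FrequencyDensity

open scoped ENNReal

/-- If translates of a weight `h` by the frequencies of a spectrum of `A` overlap at most `c` times,
then `|A| ∫ h ≤ c`. -/
theorem IsSpectrum.volume_mul_lintegral_le {d : ℕ} {A : Set (EuclideanSpace ℝ (Fin d))}
    {Λ : Set (AddChar (EuclideanSpace ℝ (Fin d)) Circle)}
    (hΛ : IsSpectrum A Λ) (hA : MeasurableSet A) (hA0 : volume A ≠ 0) (hA' : volume A ≠ ∞)
    (h : EuclideanSpace ℝ (Fin d) → ℝ≥0∞) (hh : Measurable h) (c : ℝ≥0∞)
    (hc : ∀ v : Λ → EuclideanSpace ℝ (Fin d),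
      (∀ χ ψ, χ ≠ ψ → charIntegral A (v χ - v ψ) = 0) →
      ∀ (F : Finset Λ) (u : EuclideanSpace ℝ (Fin d)), ∑ χ ∈ F, h (u + v χ) ≤ c) :
    volume A * ∫⁻ ξ, h ξ ≤ c := by
  obtain ⟨v, hcount, horth, hpars⟩ := hΛ.exists_frequencies hA0 hA'
  have hcm : Measurable fun ξ => ‖charIntegral A ξ‖ₑ ^ 2 :=
    (continuous_charIntegral hA hA').measurable.enorm.pow_const 2
  have key : volume A ^ 2 * ∫⁻ ξ, h ξ ≤ c * volume A := by
    calc volume A ^ 2 * ∫⁻ ξ, h ξ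
        -- Parseval replaces the constant |A|² by a sum over the spectrum. Translating each term
        -- moves the frequencies onto h, and Plancherel evaluates what is left.
        = ∫⁻ ξ, ∑' χ, h ξ * ‖charIntegral A (ξ - v χ)‖ₑ ^ 2 := by
          rw [← lintegral_const_mul _ hh]
          refine lintegral_congr fun ξ => ?_
          rw [ENNReal.tsum_mul_left, hpars, mul_comm]
      _ = ∑' χ, ∫⁻ ξ, h ξ * ‖charIntegral A (ξ - v χ)‖ₑ ^ 2 :=
          lintegral_tsum fun χ => (hh.mul (hcm.comp (measurable_id.sub_const _))).aemeasurable
      _ = ∑' χ, ∫⁻ u, h (u + v χ) * ‖charIntegral A u‖ₑ ^ 2 := by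
          congr 1 with χ
          rw [← lintegral_add_right_eq_self _ (v χ)]
          simp
      _ = ∫⁻ u, ∑' χ, h (u + v χ) * ‖charIntegral A u‖ₑ ^ 2 :=
          (lintegral_tsum fun χ => ((hh.comp (measurable_id.add_const _)).mul hcm).aemeasurable).symm
      _ ≤ ∫⁻ u, c * ‖charIntegral A u‖ₑ ^ 2 := by
          refine lintegral_mono fun u => ?_
          rw [ENNReal.tsum_mul_right]
          refine mul_le_mul_left ?_ _
          rw [ENNReal.tsum_eq_iSup_sum]
          exact iSup_le fun F => hc v horth F u
      _ = c * volume A := by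
          rw [lintegral_const_mul _ hcm, lintegral_enorm_sq_charIntegral hA hA']
  rw [sq, mul_assoc, mul_comm c] at key
  exact (ENNReal.mul_le_mul_iff_right hA0 hA').mp key

end FrequencyDensity

/-! ### Lattice tiles are spectral -/

section TorusSpectrum

open scoped ENNReal

attribute [local instance] instMeasureSpaceUnitAddCircle
attribute [local instance] instIsProbabilityMeasureUnitAddCircleVolume

section FundamentalDomain

variable {ι : Type*}

/-- Reduction modulo `ℤ` in every coordinate. -/
def toUnitAddTorus (w : ι → ℝ) : UnitAddTorus ι := fun i => (w i : UnitAddCircle)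

theorem measurable_toUnitAddTorus : Measurable (toUnitAddTorus (ι := ι)) :=
  measurable_pi_lambda _ fun i => AddCircle.measurable_mk'.comp (measurable_pi_apply i)

theorem toUnitAddTorus_add_intCast (w : ι → ℝ) (k : ι → ℤ) :
    toUnitAddTorus (w + fun i => (k i : ℝ)) = toUnitAddTorus w := by
  ext i
  simp only [toUnitAddTorus, Pi.add_apply, AddCircle.coe_add, add_eq_left]
  exact (AddCircle.coe_eq_zero_iff 1).mpr ⟨k i, by simp⟩

theorem exists_intCast_of_toUnitAddTorus_eq {w w' : ι → ℝ}
    (h : toUnitAddTorus w = toUnitAddTorus w') : ∃ k : ι → ℤ, w' = w + fun i => (k i : ℝ) := by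
  have h1 : ∀ i, ∃ k : ℤ, w' i = w i + k := by
    intro i
    have h2 : ((w' i - w i : ℝ) : UnitAddCircle) = 0 := by
      rw [AddCircle.coe_sub, sub_eq_zero]
      exact (congrFun h i).symm
    obtain ⟨k, hk⟩ := (AddCircle.coe_eq_zero_iff 1).mp h2
    exact ⟨k, by simp at hk; linarith⟩
  choose k hk using h1
  exact ⟨k, funext hk⟩

/-- Two fundamental domains of ℤ^ι meet a periodic set in equal measure, so W may be exchanged for
the unit cube. -/
theorem volume_preimage_toUnitAddTorus_inter [Fintype ι] {W : Set (ι → ℝ)} (hW : MeasurableSet W)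
    (hfd : ∀ w : ι → ℝ, ∃! k : ι → ℤ, w + (fun i => (k i : ℝ)) ∈ W)
    {E : Set (UnitAddTorus ι)} (hE : MeasurableSet E) :
    volume (toUnitAddTorus ⁻¹' E ∩ W) = volume E := by
  let φ : (ι → ℤ) →+ (ι → ℝ) :=
    { toFun := fun k i => (k i : ℝ)
      map_zero' := by ext; simp
      map_add' := fun a b => by ext; simp }
  have hφ : ∀ a b, φ a = φ b → a = b := fun a b hab =>
    funext fun i => Int.cast_injective (α := ℝ) (congrFun hab i)
  let G : AddSubgroup (ι → ℝ) := φ.range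
  have hG : Countable G := (Set.countable_range φ).to_subtype
  have hmk : ∀ {U : Set (ι → ℝ)}, MeasurableSet U →
      (∀ w : ι → ℝ, ∃! k : ι → ℤ, w + (fun i => (k i : ℝ)) ∈ U) →
      IsAddFundamentalDomain G U volume := by
    intro U hU hfd'
    refine IsAddFundamentalDomain.mk' hU.nullMeasurableSet fun w => ?_
    obtain ⟨k, hk, hk'⟩ := hfd' w
    refine ⟨⟨φ k, k, rfl⟩, ?_, ?_⟩
    · show φ k + w ∈ U
      rw [add_comm]
      exact hk
    · rintro ⟨_, m, rfl⟩ hm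
      have : m = k := hk' m (by
        have : φ m + w ∈ U := hm
        rwa [add_comm] at this)
      simp [this]
  have hcube : IsAddFundamentalDomain G {w : ι → ℝ | ∀ i, w i ∈ Set.Ioc (0 : ℝ) (0 + 1)} volume := by
    refine hmk (MeasurableSet.univ_pi' fun i => measurableSet_Ioc) fun w => ?_
    have h1 : ∀ i, ∃! m : ℤ, w i + m • (1 : ℝ) ∈ Set.Ioc (0 : ℝ) (0 + 1) := fun i =>
      existsUnique_add_zsmul_mem_Ioc one_pos (w i) 0
    choose k hk hk' using h1
    refine ⟨k, fun i => by simpa using hk i, fun m hm => funext fun i => hk' i (m i) ?_⟩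
    simpa using hm i
  have h1 := (hmk hW hfd).measure_set_eq hcube (A := toUnitAddTorus ⁻¹' E)
    (measurable_toUnitAddTorus hE) (by
      rintro ⟨_, m, rfl⟩
      ext w
      show toUnitAddTorus (φ m + w) ∈ E ↔ toUnitAddTorus w ∈ E
      rw [add_comm]
      erw [toUnitAddTorus_add_intCast])
  rw [h1, ← lintegral_indicator_one hE, UnitAddTorus.lintegral_preimage _ 0,
    ← Measure.restrict_apply (measurable_toUnitAddTorus hE),
    ← lintegral_indicator_one (measurable_toUnitAddTorus hE)]
  rfl

end FundamentalDomain

section LatticeTile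

variable {d : ℕ}

theorem map_toUnitAddTorus_restrict (Φ : EuclideanSpace ℝ (Fin d) ≃L[ℝ] (Fin d → ℝ))
    {D : Set (EuclideanSpace ℝ (Fin d))} (hD : MeasurableSet D)
    (hfd : ∀ w : Fin d → ℝ, ∃! k : Fin d → ℤ, Φ.symm (w + fun i => (k i : ℝ)) ∈ D) :
    ∃ c : NNReal, c ≠ 0 ∧
      (volume.restrict D).map (toUnitAddTorus ∘ Φ) = (c : ℝ≥0∞) • volume := by
  have hΦ : Measurable Φ := Φ.continuous.measurable
  have := Φ.isAddHaarMeasure_map volume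
  refine ⟨Measure.addHaarScalarFactor (volume.map Φ) volume,
    (Measure.addHaarScalarFactor_pos_of_isAddHaarMeasure _ _).ne', ?_⟩
  have hsc := Measure.isAddLeftInvariant_eq_smul (volume.map Φ) (volume : Measure (Fin d → ℝ))
  have hW : MeasurableSet (Φ.symm ⁻¹' D) := Φ.symm.continuous.measurable hD
  ext E hE
  have hE' := measurable_toUnitAddTorus hE
  rw [Measure.map_apply (measurable_toUnitAddTorus.comp hΦ) hE,
    Measure.restrict_apply ((measurable_toUnitAddTorus.comp hΦ) hE), Measure.smul_apply,
    ← volume_preimage_toUnitAddTorus_inter hW hfd hE]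
  have : (toUnitAddTorus ∘ Φ) ⁻¹' E ∩ D = Φ ⁻¹' (toUnitAddTorus ⁻¹' E ∩ Φ.symm ⁻¹' D) := by
    ext z
    simp
  rw [this, ← Measure.map_apply hΦ (hE'.inter hW)]
  nth_rewrite 1 [hsc]
  rfl

/-- The character of `ℝᵈ` obtained by pulling back a Fourier monomial of the torus. -/
noncomputable def latticeChar (Φ : EuclideanSpace ℝ (Fin d) ≃L[ℝ] (Fin d → ℝ)) (n : Fin d → ℤ) :
    AddChar (EuclideanSpace ℝ (Fin d)) Circle where
  toFun z := ∏ i, (n i • toUnitAddTorus (Φ z) i).toCircle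
  map_zero_eq_one' := by simp [toUnitAddTorus]
  map_add_eq_mul' x y := by
    simp [toUnitAddTorus, AddCircle.toCircle_add, Finset.prod_mul_distrib]

theorem coe_latticeChar (Φ : EuclideanSpace ℝ (Fin d) ≃L[ℝ] (Fin d → ℝ)) (n : Fin d → ℤ)
    (z : EuclideanSpace ℝ (Fin d)) :
    (latticeChar Φ n z : ℂ) = UnitAddTorus.mFourier n (toUnitAddTorus (Φ z)) := by
  simp only [UnitAddTorus.mFourier, ContinuousMap.coe_mk, fourier_apply]
  exact map_prod Circle.coeHom _ _

theorem continuous_latticeChar (Φ : EuclideanSpace ℝ (Fin d) ≃L[ℝ] (Fin d → ℝ)) (n : Fin d → ℤ) :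
    Continuous (latticeChar Φ n) := by
  have h : Continuous fun z => toUnitAddTorus (Φ z) := by
    refine continuous_pi fun i => ?_
    exact (AddCircle.continuous_mk' (1 : ℝ)).comp ((continuous_apply i).comp Φ.continuous)
  have hi : ∀ i, Continuous fun z => n i • toUnitAddTorus (Φ z) i := fun i =>
    ((continuous_apply i).comp h).zsmul (n i)
  have hi' : Continuous fun z => ∏ i, (n i • toUnitAddTorus (Φ z) i).toCircle :=
    continuous_finsetProd _ fun i _ => AddCircle.continuous_toCircle.comp (hi i)
  exact hi'

/-- The projection of D to the torus is bijective and carries Lebesgue measure to a multiple of Haar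
measure, so orthogonality and completeness are those of the Fourier monomials. -/
theorem exists_isSpectrum_of_lattice_tile (Φ : EuclideanSpace ℝ (Fin d) ≃L[ℝ] (Fin d → ℝ))
    {D : Set (EuclideanSpace ℝ (Fin d))} (hD : MeasurableSet D)
    (hfd : ∀ w : Fin d → ℝ, ∃! k : Fin d → ℤ, Φ.symm (w + fun i => (k i : ℝ)) ∈ D) :
    ∃ Λ, IsSpectrum D Λ := by
  obtain ⟨c, hc0, hmap⟩ := map_toUnitAddTorus_restrict Φ hD hfd
  set ν := volume.restrict D with hν
  set π : EuclideanSpace ℝ (Fin d) → UnitAddTorus (Fin d) := toUnitAddTorus ∘ Φ with hπ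
  have hπm : Measurable π := measurable_toUnitAddTorus.comp Φ.continuous.measurable
  have hνfin : IsFiniteMeasure ν := by
    refine ⟨?_⟩
    have h1 := congrArg (fun μ => μ Set.univ) hmap
    simp only [Measure.map_apply hπm MeasurableSet.univ, Set.preimage_univ, Measure.smul_apply,
      measure_univ] at h1
    rw [h1]
    simp
  have hint : ∀ g : UnitAddTorus (Fin d) → ℂ, Measurable g →
      ∫ z, g (π z) ∂ν = (c : ℝ) • ∫ x, g x := by
    intro g hg
    rw [← integral_map hπm.aemeasurable hg.aestronglyMeasurable, hmap, integral_smul_measure]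
    rfl
  have hmem : ∀ χ ∈ Set.range (latticeChar Φ), MemLp (fun z => (χ z : ℂ)) 2 ν := by
    rintro _ ⟨n, rfl⟩
    refine MemLp.of_bound ?_ 1 (.of_forall fun x => (Circle.norm_coe _).le)
    exact (continuous_subtype_val.comp (continuous_latticeChar Φ n)).aestronglyMeasurable
  have hinner : ∀ (f : Lp ℂ 2 ν) (n : Fin d → ℤ) (h : MemLp (fun z => (latticeChar Φ n z : ℂ)) 2 ν)
      (g : UnitAddTorus (Fin d) → ℂ), Measurable g → f =ᵐ[ν] g ∘ π →
      inner ℂ h.toLp f = (c : ℝ) • UnitAddTorus.mFourierCoeff g n := by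
    intro f n h g hg hfg
    rw [L2.inner_def, UnitAddTorus.mFourierCoeff,
      ← hint (fun x => UnitAddTorus.mFourier (-n) x • g x)
        ((UnitAddTorus.mFourier (-n)).continuous.measurable.smul hg)]
    refine integral_congr_ae ?_
    filter_upwards [hfg, h.coeFn_toLp] with z h1 h2
    rw [h1, h2, RCLike.inner_apply, coe_latticeChar, UnitAddTorus.mFourier_neg, mul_comm]
    rfl
  refine ⟨Set.range (latticeChar Φ), ?_, fun χ => (hmem χ.1 χ.2).toLp,
    fun χ => (hmem χ.1 χ.2).coeFn_toLp, ?_, ?_⟩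
  · rintro _ ⟨n, rfl⟩
    exact continuous_latticeChar Φ n
  · rintro ⟨_, m, rfl⟩ ⟨_, n, rfl⟩ hne
    have hmn : m ≠ n := fun h => hne (by subst h; rfl)
    rw [hinner _ m _ (UnitAddTorus.mFourier n) (UnitAddTorus.mFourier n).continuous.measurable
      ((hmem _ ⟨n, rfl⟩).coeFn_toLp.trans (.of_forall fun z => coe_latticeChar Φ n z))]
    have h1 := (UnitAddTorus.orthonormal_mFourier (d := Fin d)).2 hmn
    simp only [ContinuousMap.inner_toLp] at h1
    simp only [UnitAddTorus.mFourierCoeff, smul_eq_mul, UnitAddTorus.mFourier_neg]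
    simp only [mul_comm] at h1 ⊢
    rw [h1]
    simp
  · rw [Submodule.topologicalClosure_eq_top_iff, Submodule.eq_bot_iff]
    intro f hf
    obtain ⟨f₀, hf₀, hff₀⟩ : ∃ f₀ : EuclideanSpace ℝ (Fin d) → ℂ, Measurable f₀ ∧ f =ᵐ[ν] f₀ :=
      ⟨_, (Lp.stronglyMeasurable f).measurable, .rfl⟩
    have hinj : Function.Injective fun z : D => π z := by
      rintro ⟨z, hz⟩ ⟨z', hz'⟩ h
      obtain ⟨k, hk⟩ := exists_intCast_of_toUnitAddTorus_eq h
      have h0 := (hfd (Φ z)).unique (y₁ := 0) (y₂ := k)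
        (by
          have : (Φ z + fun i => (((0 : Fin d → ℤ) i : ℤ) : ℝ)) = Φ z := by ext; simp
          rw [this]; simpa using hz)
        (by rw [← hk]; simpa using hz')
      subst h0
      have : Φ z' = Φ z := by rw [hk]; ext; simp
      exact Subtype.ext (Φ.injective this.symm)
    have := hD.standardBorel
    -- An injective Borel map between standard Borel spaces is an embedding; hence f descends to a
    -- measurable g on the torus.
    have hemb : MeasurableEmbedding fun z : D => π z :=
      (hπm.comp measurable_subtype_coe).measurableEmbedding hinj
    obtain ⟨g, hg, hgf⟩ := hemb.exists_measurable_extend (hf₀.comp measurable_subtype_coe)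
      fun _ => ⟨0⟩
    have hfg : f =ᵐ[ν] g ∘ π := by
      filter_upwards [hff₀, ae_restrict_mem hD] with z h1 h2
      rw [h1]
      exact (congrFun hgf ⟨z, h2⟩).symm
    have hgL : MemLp g 2 volume := by
      have h1 : MemLp g 2 (ν.map π) :=
        (memLp_map_measure_iff hg.aestronglyMeasurable hπm.aemeasurable).mpr
          ((memLp_congr_ae hfg).mp (Lp.memLp f))
      refine h1.of_measure_le_smul (c := (c : ℝ≥0∞)⁻¹) (by simpa using hc0) ?_
      rw [hmap, smul_smul, ENNReal.inv_mul_cancel (by simpa using hc0) (by simp), one_smul]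
    have hcoef : ∀ n, UnitAddTorus.mFourierCoeff g n = 0 := by
      intro n
      have h1 := hinner f n (hmem _ ⟨n, rfl⟩) g hg hfg
      rw [(Submodule.mem_orthogonal _ _).mp hf _ (Submodule.subset_span ⟨⟨_, n, rfl⟩, rfl⟩)] at h1
      exact (smul_eq_zero.mp h1.symm).resolve_left (by exact_mod_cast hc0)
    have hg0 : hgL.toLp = 0 := by
      apply UnitAddTorus.mFourierBasis.repr.injective
      rw [map_zero]
      ext n
      rw [UnitAddTorus.mFourierBasis_repr]
      have : UnitAddTorus.mFourierCoeff hgL.toLp n = UnitAddTorus.mFourierCoeff g n :=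
        integral_congr_ae (hgL.coeFn_toLp.mono fun x hx => by simp only [hx])
      rw [this, hcoef]
      rfl
    have hg0' : g =ᵐ[volume] 0 := by
      have h1 := hgL.coeFn_toLp
      rw [hg0] at h1
      exact h1.symm.trans (Lp.coeFn_zero _ _ _)
    rw [Lp.eq_zero_iff_ae_eq_zero]
    refine hfg.trans ?_
    refine ae_of_ae_map (p := fun x => g x = 0) hπm.aemeasurable ?_
    rw [hmap]
    exact Measure.ae_smul_measure hg0' _

end LatticeTile

end TorusSpectrum

/-! ### Unions of unit cubes and their transforms -/

section CubeUnion

open scoped ENNReal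

variable {d : ℕ}

theorem measurableSet_euclidean_box (a b : Fin d → ℝ) :
    MeasurableSet {x : EuclideanSpace ℝ (Fin d) | ∀ i, x i ∈ Set.Ico (a i) (b i)} := by
  have h := (PiLp.volume_preserving_ofLp (Fin d)).measurable
    (MeasurableSet.univ_pi fun i => measurableSet_Ico (a := a i) (b := b i))
  convert h
  ext x
  simp

theorem volume_euclidean_box (a b : Fin d → ℝ) :
    volume {x : EuclideanSpace ℝ (Fin d) | ∀ i, x i ∈ Set.Ico (a i) (b i)} =
      ∏ i, ENNReal.ofReal (b i - a i) := by
  rw [← Real.volume_pi_Ico, ← (PiLp.volume_preserving_ofLp (Fin d)).measure_preimage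
    (MeasurableSet.univ_pi fun i => measurableSet_Ico).nullMeasurableSet]
  congr 1
  ext x
  simp

/-- The union of the unit cubes `a + [0,1)ᵈ` with lower corners `a ∈ F`. -/
def cubeUnion (F : Set (Fin d → ℤ)) : Set (EuclideanSpace ℝ (Fin d)) :=
  {x | (fun i => ⌊x i⌋) ∈ F}

theorem measurableSet_cubeUnion (F : Set (Fin d → ℤ)) : MeasurableSet (cubeUnion F) := by
  have h : Measurable fun x : EuclideanSpace ℝ (Fin d) => fun i => ⌊x i⌋ :=
    measurable_pi_lambda _ fun i => Int.measurable_floor.comp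
      ((measurable_pi_apply i).comp (PiLp.volume_preserving_ofLp (Fin d)).measurable)
  exact h (MeasurableSet.of_discrete)

theorem cubeUnion_singleton (a : Fin d → ℤ) :
    cubeUnion {a} = {x : EuclideanSpace ℝ (Fin d) | ∀ i, x i ∈ Set.Ico (a i : ℝ) (a i + 1)} := by
  ext x
  simp only [cubeUnion, Set.mem_singleton_iff, Set.mem_ofPred_eq, funext_iff, Int.floor_eq_iff,
    Set.mem_Ico]

theorem volume_cubeUnion_singleton (a : Fin d → ℤ) : volume (cubeUnion {a}) = 1 := by
  rw [cubeUnion_singleton, volume_euclidean_box]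
  simp

theorem cubeUnion_eq_biUnion (F : Finset (Fin d → ℤ)) :
    cubeUnion (F : Set (Fin d → ℤ)) = ⋃ a ∈ F, cubeUnion {a} := by
  ext x
  simp [cubeUnion]

theorem pairwiseDisjoint_cubeUnion (F : Set (Fin d → ℤ)) :
    F.PairwiseDisjoint fun a => cubeUnion {a} := by
  intro a _ b _ hab
  refine Set.disjoint_left.mpr fun x hx hy => hab ?_
  simp only [cubeUnion, Set.mem_singleton_iff, Set.mem_ofPred_eq] at hx hy
  rw [← hx, ← hy]

theorem volume_cubeUnion (F : Finset (Fin d → ℤ)) :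
    volume (cubeUnion (F : Set (Fin d → ℤ))) = F.card := by
  rw [cubeUnion_eq_biUnion, measure_biUnion_finset (pairwiseDisjoint_cubeUnion _)
    fun a _ => measurableSet_cubeUnion _]
  simp [volume_cubeUnion_singleton]

theorem isBounded_cubeUnion {F : Set (Fin d → ℤ)} (hF : F.Finite) :
    Bornology.IsBounded (cubeUnion F) := by
  have h : cubeUnion F = ⋃ a ∈ F, cubeUnion {a} := by
    ext x
    simp [cubeUnion]
  rw [h, Bornology.isBounded_biUnion hF]
  intro a _
  have h1 : Bornology.IsBounded
      (Set.univ.pi fun i : Fin d => Set.Icc (a i : ℝ) (a i + 1)) :=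
    Bornology.IsBounded.pi fun i => Metric.isBounded_Icc _ _
  refine ((PiLp.lipschitzWith_toLp 2 fun _ : Fin d => ℝ).isBounded_image h1).subset ?_
  intro x hx
  rw [cubeUnion_singleton] at hx
  exact ⟨x.ofLp, fun i _ => ⟨(hx i).1, (hx i).2.le⟩, rfl⟩

/-- The trigonometric sum `∑_{a ∈ F} exp (2πi⟨ξ, a⟩)`. -/
noncomputable def expSum (F : Finset (Fin d → ℤ)) (ξ : Fin d → ℝ) : ℂ :=
  ∑ a ∈ F, (Real.fourierChar (∑ i, ξ i * a i) : ℂ)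

/-- For t ≠ 0 the integral is (exp (2πit) - 1) / (2πit), which vanishes only at nonzero integers. -/
theorem integral_fourierChar_ne_zero {t : ℝ} (ht : |t| < 1) :
    ∫ x in Set.Ico (0 : ℝ) 1, (Real.fourierChar (t * x) : ℂ) ≠ 0 := by
  rw [integral_Ico_eq_integral_Ioo, ← integral_Ioc_eq_integral_Ioo,
    ← intervalIntegral.integral_of_le zero_le_one]
  rcases eq_or_ne t 0 with rfl | h0
  · simp
  have hpi := Real.pi_ne_zero
  have hc : (2 * Real.pi * t * Complex.I : ℂ) ≠ 0 := by
    simp [h0, hpi]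
  have h1 : ∀ x : ℝ, (Real.fourierChar (t * x) : ℂ)
      = Complex.exp ((2 * Real.pi * t * Complex.I) * x) := fun x => by
    rw [Real.fourierChar_apply]
    congr 1
    push_cast
    ring
  simp only [h1]
  rw [integral_exp_mul_complex hc]
  refine div_ne_zero (fun h => ?_) hc
  rw [sub_eq_zero] at h
  simp only [Complex.ofReal_one, Complex.ofReal_zero, mul_one, mul_zero, Complex.exp_zero] at h
  obtain ⟨n, hn⟩ := Complex.exp_eq_one_iff.mp h
  have hn' : (t : ℂ) = n := by
    have h2 : (2 * Real.pi * Complex.I : ℂ) ≠ 0 := by simp [hpi]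
    apply mul_right_cancel₀ h2
    linear_combination hn
  have hn'' : t = n := by exact_mod_cast hn'
  rw [hn''] at ht h0
  have h3 : |n| < 1 := by exact_mod_cast ht
  rw [Int.abs_lt_one_iff] at h3
  exact h0 (by simp [h3])

theorem charIntegral_cubeUnion_zero_ne_zero {ξ : EuclideanSpace ℝ (Fin d)}
    (hξ : ∀ i, |ξ i| < 1) : charIntegral (cubeUnion {0}) ξ ≠ 0 := by
  have h1 : charIntegral (cubeUnion {0}) ξ =
      ∏ i, ∫ x in Set.Ico (0 : ℝ) 1, (Real.fourierChar (ξ i * x) : ℂ) := by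
    rw [← integral_fintype_prod_eq_prod (fun i x => (Real.fourierChar (ξ i * x) : ℂ)),
      ← Measure.restrict_pi_pi, ← volume_pi,
      ← (PiLp.volume_preserving_ofLp (Fin d)).setIntegral_preimage_emb
        (MeasurableEquiv.toLp 2 (Fin d → ℝ)).symm.measurableEmbedding, charIntegral]
    have hs : cubeUnion {0} = (@WithLp.ofLp 2 (Fin d → ℝ)) ⁻¹'
        (Set.univ.pi fun _ => Set.Ico (0 : ℝ) 1) := by
      rw [cubeUnion_singleton]
      ext x
      simp
    rw [← hs]
    refine integral_congr_ae (.of_forall fun x => ?_)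
    simp only [innerChar_apply, PiLp.inner_apply]
    have h2 : (Real.fourierChar (∑ i, inner ℝ (ξ i) (x i)) : Circle) =
        ∏ i, Real.fourierChar (ξ i * x i) := by
      simp only [RCLike.inner_apply, conj_trivial, mul_comm]
      exact map_prod Real.fourierChar.toMonoidHom
        (fun i => Multiplicative.ofAdd (ξ i * x i)) Finset.univ
    rw [h2]
    exact map_prod Circle.coeHom _ _
  rw [h1]
  exact Finset.prod_ne_zero_iff.mpr fun i _ => integral_fourierChar_ne_zero (hξ i)

theorem charIntegral_cubeUnion (F : Finset (Fin d → ℤ)) (ξ : EuclideanSpace ℝ (Fin d)) :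
    charIntegral (cubeUnion (F : Set (Fin d → ℤ))) ξ =
      expSum F ξ * charIntegral (cubeUnion {0}) ξ := by
  have hint : ∀ a : Fin d → ℤ, IntegrableOn (fun x => (innerChar ξ x : ℂ)) (cubeUnion {a}) := by
    intro a
    have hfin : volume (cubeUnion {a}) ≠ ∞ := by simp [volume_cubeUnion_singleton]
    have : IsFiniteMeasure (volume.restrict (cubeUnion {a})) := ⟨by simpa using hfin.lt_top⟩
    exact (memLp_innerChar hfin ξ).integrable (by norm_num)
  have hshift : ∀ a : Fin d → ℤ, charIntegral (cubeUnion {a}) ξ =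
      (Real.fourierChar (∑ i, ξ i * a i) : ℂ) * charIntegral (cubeUnion {0}) ξ := by
    intro a
    let v : EuclideanSpace ℝ (Fin d) := WithLp.toLp 2 fun i => (a i : ℝ)
    have hpre : (fun x => x + v) ⁻¹' cubeUnion {a} = cubeUnion {0} := by
      ext x
      simp [cubeUnion, v, funext_iff]
    rw [charIntegral, ← (measurePreserving_add_right volume v).setIntegral_preimage_emb
      (measurableEmbedding_addRight v), hpre, charIntegral, ← integral_const_mul]
    refine integral_congr_ae (.of_forall fun x => ?_)
    simp only [AddChar.map_add_eq_mul, Circle.coe_mul]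
    rw [mul_comm]
    congr 2
    simp only [innerChar_apply, PiLp.inner_apply, v, RCLike.inner_apply, conj_trivial, mul_comm]
    rfl
  rw [charIntegral, cubeUnion_eq_biUnion, integral_biUnion_finset _
    (fun a _ => measurableSet_cubeUnion _) (pairwiseDisjoint_cubeUnion _) (fun a _ => hint a),
    expSum, Finset.sum_mul]
  exact Finset.sum_congr rfl fun a _ => hshift a

end CubeUnion

/-! ### Exponential sums over periodic sets -/

section PeriodicSet

open scoped ENNReal

variable {d : ℕ}

open Classical in
/-- The points of `𝒜` in the discrete box `{0, …, M - 1}ᵈ`. -/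
noncomputable def boxPart (𝒜 : Set (Fin d → ℤ)) (M : ℕ) : Finset (Fin d → ℤ) :=
  (Fintype.piFinset fun _ => Finset.Ico 0 (M : ℤ)).filter (· ∈ 𝒜)

theorem mem_boxPart {𝒜 : Set (Fin d → ℤ)} {M : ℕ} {x : Fin d → ℤ} :
    x ∈ boxPart 𝒜 M ↔ (∀ i, 0 ≤ x i ∧ x i < M) ∧ x ∈ 𝒜 := by
  simp [boxPart]

theorem coe_fourierChar_sum (f : Fin d → ℝ) :
    (Real.fourierChar (∑ i, f i) : ℂ) = ∏ i, (Real.fourierChar (f i) : ℂ) := by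
  have h : (Real.fourierChar (∑ i, f i) : Circle) = ∏ i, Real.fourierChar (f i) :=
    map_prod Real.fourierChar.toMonoidHom (fun i => Multiplicative.ofAdd (f i)) Finset.univ
  rw [h]
  exact map_prod Circle.coeHom _ _

theorem coe_fourierChar_add (x y : ℝ) :
    (Real.fourierChar (x + y) : ℂ) = Real.fourierChar x * Real.fourierChar y := by
  rw [AddChar.map_add_eq_mul, Circle.coe_mul]

/-- Division with remainder by m splits the large box into Nᵈ translates of the small one, and the
phases multiply. -/
theorem expSum_boxPart_mul {𝒜 : Set (Fin d → ℤ)} {m : ℕ} (hm : 0 < m)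
    (hper : ∀ x k : Fin d → ℤ, (fun i => x i + m * k i) ∈ 𝒜 ↔ x ∈ 𝒜) (N : ℕ) (ξ : Fin d → ℝ) :
    expSum (boxPart 𝒜 (m * N)) ξ = expSum (boxPart 𝒜 m) ξ *
      ∏ i, ∑ j ∈ Finset.range N, (Real.fourierChar (ξ i * (m * j)) : ℂ) := by
  have hm' : (0 : ℤ) < m := by exact_mod_cast hm
  rw [Finset.prod_univ_sum, expSum, expSum, Finset.sum_mul_sum, ← Finset.sum_product']
  refine (Finset.sum_nbij' (fun p : (Fin d → ℤ) × (Fin d → ℕ) => fun i => p.1 i + m * p.2 i)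
    (fun x => (fun i => x i % m, fun i => (x i / m).toNat)) ?_ ?_ ?_ ?_ ?_).symm
  · rintro ⟨a, j⟩ hp
    simp only [Finset.mem_product, mem_boxPart, Fintype.mem_piFinset, Finset.mem_range] at hp ⊢
    obtain ⟨⟨ha, haA⟩, hj⟩ := hp
    refine ⟨fun i => ⟨by have := (ha i).1; positivity, ?_⟩, (hper a fun i => j i).mpr haA⟩
    have h1 := (ha i).2
    have h2 : (j i : ℤ) + 1 ≤ N := by exact_mod_cast hj i
    push_cast
    nlinarith
  · intro x hx
    simp only [Finset.mem_product, mem_boxPart, Fintype.mem_piFinset, Finset.mem_range] at hx ⊢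
    obtain ⟨hb, hxA⟩ := hx
    refine ⟨⟨fun i => ⟨Int.emod_nonneg _ hm'.ne', Int.emod_lt_of_pos _ hm'⟩, ?_⟩, fun i => ?_⟩
    · rw [← hper _ fun i => x i / m]
      simpa only [Int.emod_add_mul_ediv] using hxA
    · have h1 : x i / m < N := by
        rw [Int.ediv_lt_iff_lt_mul hm']
        have := (hb i).2
        push_cast at this
        linarith
      have h2 := Int.ediv_nonneg (hb i).1 hm'.le
      omega
  · rintro ⟨a, j⟩ hp
    simp only [Finset.mem_product, mem_boxPart, Fintype.mem_piFinset, Finset.mem_range] at hp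
    obtain ⟨⟨ha, -⟩, -⟩ := hp
    ext i
    · simp [Int.emod_eq_of_lt (ha i).1 (ha i).2]
    · simp [Int.add_mul_ediv_left _ _ hm'.ne', Int.ediv_eq_zero_of_lt (ha i).1 (ha i).2]
  · intro x hx
    rw [mem_boxPart] at hx
    ext i
    have h2 := Int.ediv_nonneg (hx.1 i).1 hm'.le
    simp only [Int.toNat_of_nonneg h2, Int.emod_add_mul_ediv]
  · rintro ⟨a, j⟩ -
    simp only
    rw [coe_fourierChar_sum, coe_fourierChar_sum, ← Finset.prod_mul_distrib]
    refine Finset.prod_congr rfl fun i _ => ?_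
    rw [← coe_fourierChar_add]
    congr 2
    push_cast
    ring

theorem coe_fourierChar_intCast (n : ℤ) : (Real.fourierChar (n : ℝ) : ℂ) = 1 := by
  rw [Real.fourierChar_apply, Complex.exp_eq_one_iff]
  exact ⟨n, by push_cast; ring⟩

theorem coe_fourierChar_eq_one_iff (t : ℝ) : (Real.fourierChar t : ℂ) = 1 ↔ ∃ n : ℤ, t = n := by
  refine ⟨fun h => ?_, by rintro ⟨n, rfl⟩; exact coe_fourierChar_intCast n⟩
  rw [Real.fourierChar_apply, Complex.exp_eq_one_iff] at h
  obtain ⟨n, hn⟩ := h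
  refine ⟨n, ?_⟩
  have hpi := Real.pi_ne_zero
  have h2 : (2 * Real.pi * Complex.I : ℂ) ≠ 0 := by simp [hpi]
  have : (t : ℂ) = n := by
    apply mul_right_cancel₀ h2
    push_cast at hn
    linear_combination hn
  exact_mod_cast this

theorem coe_fourierChar_nat_mul (t : ℝ) (j : ℕ) :
    (Real.fourierChar (t * j) : ℂ) = (Real.fourierChar t : ℂ) ^ j := by
  rw [mul_comm, ← nsmul_eq_mul, AddChar.map_nsmul_eq_pow, Circle.coe_pow]

/-- Since q ∣ m, the term k/q drops out and a geometric sum of ratio exp (2πiδm) remains. It could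
vanish only if δmN were a nonzero integer. -/
theorem sum_fourierChar_ne_zero {m q N : ℕ} (hq : 0 < q) (hqm : q ∣ m) (hN : 0 < N) (k : ℤ) {δ : ℝ}
    (hδ : |δ| * (m * N) < 1) :
    ∑ j ∈ Finset.range N, (Real.fourierChar ((k / q + δ) * (m * j)) : ℂ) ≠ 0 := by
  obtain ⟨r, rfl⟩ := hqm
  have hq' : (q : ℝ) ≠ 0 := by exact_mod_cast hq.ne'
  have h1 : ∀ j : ℕ, (Real.fourierChar ((k / q + δ) * ((q * r : ℕ) * j)) : ℂ) =
      (Real.fourierChar (δ * (q * r : ℕ)) : ℂ) ^ j := by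
    intro j
    rw [← coe_fourierChar_nat_mul, show ((k / q + δ) * ((q * r : ℕ) * j) : ℝ) =
      ((k * r * j : ℤ) : ℝ) + δ * (q * r : ℕ) * j by push_cast; field_simp,
      coe_fourierChar_add, coe_fourierChar_intCast, one_mul]
  simp only [h1]
  by_cases hz : (Real.fourierChar (δ * (q * r : ℕ)) : ℂ) = 1
  · simp only [hz, one_pow]
    simp [hN.ne']
  · rw [geom_sum_eq hz]
    refine div_ne_zero (fun h => hz ?_) (sub_ne_zero.mpr hz)
    rw [sub_eq_zero, ← coe_fourierChar_nat_mul, coe_fourierChar_eq_one_iff] at h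
    obtain ⟨n, hn⟩ := h
    have h2 : |(n : ℝ)| < 1 := by
      rw [← hn, abs_mul, abs_mul, Nat.abs_cast, Nat.abs_cast, mul_assoc]
      exact hδ
    have h3 : |n| < 1 := by exact_mod_cast h2
    rw [Int.abs_lt_one_iff] at h3
    rw [h3, Int.cast_zero, mul_eq_zero] at hn
    have h4 : δ * (q * r : ℕ) = 0 := hn.resolve_right (by exact_mod_cast hN.ne')
    rw [h4]
    simp

theorem continuous_expSum (F : Finset (Fin d → ℤ)) : Continuous (expSum F) := by
  refine continuous_finsetSum _ fun a _ => ?_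
  exact continuous_subtype_val.comp (Real.continuous_fourierChar.comp (by fun_prop))

theorem exists_pos_expSum_ne_zero (F : Finset (Fin d → ℤ)) {ι : Type*} [Finite ι]
    (c : ι → Fin d → ℝ) (hc : ∀ k, expSum F (c k) ≠ 0) :
    ∃ ε > 0, ∀ k, ∀ δ : Fin d → ℝ, (∀ i, |δ i| < ε) → expSum F (c k + δ) ≠ 0 := by
  have h : ∀ᶠ δ in nhds (0 : Fin d → ℝ), ∀ k, expSum F (c k + δ) ≠ 0 := by
    rw [Filter.eventually_all]
    intro k
    have h1 : Continuous fun δ => expSum F (c k + δ) :=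
      (continuous_expSum F).comp (continuous_const.add continuous_id)
    exact h1.continuousAt.eventually_ne (by simpa using hc k)
  obtain ⟨ε, hε, hb⟩ := Metric.eventually_nhds_iff.mp h
  refine ⟨ε, hε, fun k δ hδ => hb ?_ k⟩
  rw [dist_zero_right, pi_norm_lt_iff hε]
  exact hδ

end PeriodicSet

/-! ### The obstruction to spectrality -/

section NotSpectral

open scoped ENNReal Pointwise

variable {d : ℕ}

/-- A set of residues all of whose mutual differences avoid `S - S` has at most `qᵈ / |S|`
elements. -/
theorem card_mul_card_le_of_sub_notMem {G ι : Type*} [AddCommGroup G] [Fintype G] [DecidableEq G]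
    (S : Finset G) (P : Finset ι) (f : ι → G)
    (h : ∀ p ∈ P, ∀ p' ∈ P, f p - f p' ∈ S - S → p = p') : P.card * S.card ≤ Fintype.card G := by
  rw [← Finset.card_product]
  -- The translates f p + S are disjoint: a common point would put f p - f p' in S - S.
  refine Finset.card_le_card_of_injOn (fun x : ι × G => f x.1 + x.2) (fun _ _ => Finset.mem_univ _) ?_
  rintro ⟨p, s⟩ hp ⟨p', s'⟩ hp' heq
  simp only [Finset.coe_product, Set.mem_prod, Finset.mem_coe] at hp hp' heq
  have h1 : f p - f p' = s' - s := by
    rw [sub_eq_sub_iff_add_eq_add, heq, add_comm]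
  have h2 := h p hp.1 p' hp'.1 (h1 ▸ Finset.sub_mem_sub hp'.2 hp.2)
  subst h2
  simpa using heq

theorem charIntegral_cubeUnion_boxPart_ne_zero {𝒜 : Set (Fin d → ℤ)} {m q N : ℕ} (hq : 0 < q)
    (hm : 0 < m) (hqm : q ∣ m) (hN : 0 < N)
    (hper : ∀ x k : Fin d → ℤ, (fun i => x i + m * k i) ∈ 𝒜 ↔ x ∈ 𝒜)
    (k : Fin d → ℤ) (hk : ∀ i, |k i| < q) (δ : Fin d → ℝ) (hδ : ∀ i, |δ i| * (m * N) < 1)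
    (hne : expSum (boxPart 𝒜 m) (fun i => k i / q + δ i) ≠ 0) :
    charIntegral (cubeUnion (boxPart 𝒜 (m * N) : Set (Fin d → ℤ)))
      (WithLp.toLp 2 fun i => k i / q + δ i) ≠ 0 := by
  rw [charIntegral_cubeUnion, expSum_boxPart_mul hm hper]
  refine mul_ne_zero (mul_ne_zero hne (Finset.prod_ne_zero_iff.mpr fun i _ =>
    sum_fourierChar_ne_zero hq hqm hN (k i) (hδ i))) (charIntegral_cubeUnion_zero_ne_zero fun i => ?_)
  have hq' : (0 : ℝ) < q := by exact_mod_cast hq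
  have h1 : (|k i| : ℝ) + 1 ≤ q := by exact_mod_cast hk i
  have h2 : (q : ℝ) ≤ m * N := by
    have : q ≤ m * N := (Nat.le_of_dvd hm hqm).trans (Nat.le_mul_of_pos_right m hN)
    exact_mod_cast this
  have h3 : |δ i| * q < 1 := (mul_le_mul_of_nonneg_left h2 (abs_nonneg _)).trans_lt (hδ i)
  have h4 : |(k i / q + δ i : ℝ)| * q ≤ |(k i : ℝ)| + |δ i| * q := by
    have h5 : (k i / q + δ i : ℝ) * q = k i + δ i * q := by
      rw [add_mul, div_mul_cancel₀ _ hq'.ne']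
    calc |(k i / q + δ i : ℝ)| * q = |(k i + δ i * q : ℝ)| := by rw [← h5, abs_mul, abs_of_pos hq']
      _ ≤ |(k i : ℝ)| + |δ i * q| := abs_add_le _ _
      _ = _ := by rw [abs_mul, abs_of_pos hq']
  show |(k i / q + δ i : ℝ)| < 1
  have h5 : |(k i / q + δ i : ℝ)| * q < 1 * q := by linarith
  exact lt_of_mul_lt_mul_right h5 hq'.le

/-- A periodic set of density at least `1 / |S|` whose Fourier coefficients do not vanish on `S - S`
yields non-spectral unions of cubes, if `|S|` does not divide the order of the group of
frequencies containing `S`. -/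
theorem exists_not_isSpectrum_cubeUnion {𝒜 : Set (Fin d → ℤ)} {m q : ℕ} [NeZero q]
    (hm : 0 < m) (hqm : q ∣ m)
    (hper : ∀ x k : Fin d → ℤ, (fun i => x i + m * k i) ∈ 𝒜 ↔ x ∈ 𝒜)
    (S : Finset (Fin d → ZMod q)) (hS : ¬ S.card ∣ q ^ d)
    (hdens : ∀ N, (m * N) ^ d ≤ (boxPart 𝒜 (m * N)).card * S.card)
    (hfour : ∀ k : Fin d → ℤ, (fun i => (k i : ZMod q)) ∈ S - S →
      expSum (boxPart 𝒜 m) (fun i => k i / q) ≠ 0) :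
    ∃ N, 0 < N ∧ ∀ Λ, ¬ IsSpectrum (cubeUnion (boxPart 𝒜 (m * N) : Set (Fin d → ℤ))) Λ := by
  have hq : 0 < q := NeZero.pos q
  have hq' : (0 : ℝ) < q := by exact_mod_cast hq
  have hm' : (0 : ℝ) < m := by exact_mod_cast hm
  -- Differences of labels from {0, …, q - 1} lie in this range. Finiteness gives one ε for all of
  -- them, and then N is chosen with 1/(mN) < ε.
  let K := {k : Fin d → ℤ // (∀ i, k i ∈ Set.Ioo (-q : ℤ) q) ∧ (fun i => (k i : ZMod q)) ∈ S - S}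
  have hK : Finite K := by
    have h1 : (Set.univ.pi fun _ : Fin d => Set.Ioo (-q : ℤ) q).Finite :=
      Set.Finite.pi fun _ => Set.finite_Ioo _ _
    exact (h1.subset fun k hk i _ => hk.1 i : {k : Fin d → ℤ | (∀ i, k i ∈ Set.Ioo (-q : ℤ) q) ∧
      (fun i => (k i : ZMod q)) ∈ S - S}.Finite).to_subtype
  obtain ⟨ε, hε, hεne⟩ := exists_pos_expSum_ne_zero (boxPart 𝒜 m)
    (fun (k : K) i => (k.1 i : ℝ) / q) fun k => hfour k.1 k.2.2
  obtain ⟨N, hN⟩ := exists_nat_gt (max 1 (1 / (ε * m)))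
  have hN1 : (1 : ℝ) < N := (le_max_left _ _).trans_lt hN
  have hN0 : 0 < N := by
    have : (0 : ℝ) < N := one_pos.trans hN1
    exact_mod_cast this
  have hεN : 1 < ε * (m * N) := by
    have h1 := (le_max_right _ _).trans_lt hN
    rw [div_lt_iff₀ (by positivity)] at h1
    linarith
  refine ⟨N, hN0, fun Λ hΛ => ?_⟩
  set M : ℝ := m * N with hM
  have hM0 : 0 < M := by positivity
  have hqM : (q : ℝ) ≤ M := by
    have : q ≤ m * N := (Nat.le_of_dvd hm hqm).trans (Nat.le_mul_of_pos_right m hN0)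
    rw [hM]
    exact_mod_cast this
  set F := boxPart 𝒜 (m * N) with hF
  have hcardF : 0 < F.card * S.card := lt_of_lt_of_le (by positivity) (hdens N)
  let box : (Fin d → Fin q) → Set (EuclideanSpace ℝ (Fin d)) := fun k =>
    {x | ∀ i, x i ∈ Set.Ico ((k i : ℕ) / q : ℝ) ((k i : ℕ) / q + M⁻¹)}
  have hbox : ∀ k, MeasurableSet (box k) := fun k => measurableSet_euclidean_box _ _
  have key := hΛ.volume_mul_lintegral_le (measurableSet_cubeUnion _)
    (by rw [volume_cubeUnion]; exact_mod_cast (Nat.pos_of_mul_pos_right hcardF).ne')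
    (by rw [volume_cubeUnion]; exact ENNReal.natCast_ne_top _)
    (fun x => ∑ k, (box k).indicator 1 x)
    (Finset.measurable_sum _ fun k _ => measurable_one.indicator (hbox k))
    -- The quotient is rounded down, because hits are counted by an integer. The contradiction lies
    -- in this rounding.
    ((q ^ d / S.card : ℕ) : ℝ≥0∞) (by
      intro v hv X u
      classical
      let P := (X ×ˢ (Finset.univ : Finset (Fin d → Fin q))).filter fun p => u + v p.1 ∈ box p.2
      have hP : ∑ χ ∈ X, ∑ k, (box k).indicator (1 : EuclideanSpace ℝ (Fin d) → ℝ≥0∞) (u + v χ) = P.card := by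
        rw [← Finset.sum_product', Finset.card_filter, Nat.cast_sum]
        refine Finset.sum_congr rfl fun p _ => ?_
        by_cases hp : u + v p.1 ∈ box p.2 <;> simp [hp]
      rw [hP]
      refine Nat.cast_le.mpr ((Nat.le_div_iff_mul_le (Nat.pos_of_mul_pos_left hcardF)).mpr ?_)
      have hcardG : Fintype.card (Fin d → ZMod q) = q ^ d := by
        rw [Fintype.card_fun, ZMod.card, Fintype.card_fin]
      rw [← hcardG]
      refine card_mul_card_le_of_sub_notMem S P
        (fun p i => (((p.2 i : ℕ) : ℤ) : ZMod q)) ?_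
      rintro ⟨χ, k⟩ hp ⟨χ', k'⟩ hp' hmem
      simp only [P, Finset.mem_filter, Finset.mem_product, Finset.mem_univ, and_true] at hp hp'
      set κ : Fin d → ℤ := fun i => ((k i : ℕ) : ℤ) - ((k' i : ℕ) : ℤ) with hκ
      set δ : Fin d → ℝ := fun i => (v χ i - v χ' i) - κ i / q with hδ
      have hκq : ∀ i, |κ i| < q := by
        intro i
        have h1 := (k i).2
        have h2 := (k' i).2
        rw [abs_lt, hκ]
        constructor <;> simp only <;> omega
      have hδM : ∀ i, |δ i| < M⁻¹ := by
        intro i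
        obtain ⟨h1, h2⟩ := hp.2 i
        obtain ⟨h3, h4⟩ := hp'.2 i
        simp only [PiLp.add_apply] at h1 h2 h3 h4
        simp only [hδ, hκ]
        push_cast
        rw [sub_div, abs_lt]
        constructor <;> linarith
      have hκmem : (fun i => (κ i : ZMod q)) ∈ S - S := by
        convert hmem using 1
        ext i
        simp [hκ]
      -- One frequency hits at most one box, as boxes of side 1/M ≤ 1/q at distinct points are
      -- disjoint. Distinct frequencies would differ by a point where the transform is nonzero.
      by_cases hχ : χ = χ'
      · subst hχ
        have h1 : ∀ i, k i = k' i := by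
          intro i
          have h2 := hδM i
          simp only [hδ, sub_self, zero_sub, abs_neg, abs_div, Nat.abs_cast] at h2
          rw [div_lt_iff₀ hq'] at h2
          have h3 : M⁻¹ * q ≤ 1 := by
            rw [inv_mul_le_iff₀ hM0, mul_one]
            exact hqM
          have h4 : |(κ i : ℝ)| < 1 := h2.trans_le h3
          have h5 : |κ i| < 1 := by exact_mod_cast h4
          rw [Int.abs_lt_one_iff] at h5
          simp only [hκ] at h5
          exact Fin.ext (by omega)
        rw [funext h1]
      · exfalso
        refine charIntegral_cubeUnion_boxPart_ne_zero hq hm hqm hN0 hper κ hκq δ (fun i => ?_) ?_ ?_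
        · have h1 := hδM i
          rwa [← one_div, lt_div_iff₀ hM0] at h1
        · exact hεne ⟨κ, fun i => abs_lt.mp (hκq i), hκmem⟩ δ fun i => (hδM i).trans (by
            rw [inv_lt_iff_one_lt_mul₀ hM0]
            linarith)
        · have h1 : (WithLp.toLp 2 fun i => (κ i : ℝ) / q + δ i) = v χ - v χ' := by
            ext i
            simp [hδ]
          rw [h1]
          exact hv χ χ' hχ)
  have hlint : ∫⁻ x, ∑ k, (box k).indicator 1 x = (q : ℝ≥0∞) ^ d * ENNReal.ofReal M⁻¹ ^ d := by
    rw [lintegral_finsetSum _ fun k _ => measurable_one.indicator (hbox k)]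
    have h1 : ∀ k, ∫⁻ x, (box k).indicator 1 x = ENNReal.ofReal M⁻¹ ^ d := by
      intro k
      rw [lintegral_indicator_one (hbox k), volume_euclidean_box]
      simp
    simp only [h1]
    simp
  rw [hlint, volume_cubeUnion] at key
  have key2 : (F.card : ℝ) * (q ^ d * M⁻¹ ^ d) ≤ (q ^ d / S.card : ℕ) := by
    have h1 := ENNReal.toReal_mono (ENNReal.natCast_ne_top _) key
    simpa [ENNReal.toReal_ofReal (inv_nonneg.mpr hM0.le)] using h1
  have hS0 : 0 < S.card := Nat.pos_of_mul_pos_left hcardF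
  have hd : (M ^ d : ℝ) ≤ F.card * S.card := by
    have := hdens N
    rw [hM]
    exact_mod_cast this
  have hle : q ^ d ≤ q ^ d / S.card * S.card := by
    have h2 : (q ^ d : ℝ) ≤ (q ^ d / S.card : ℕ) * S.card := by
      calc (q ^ d : ℝ) = M ^ d * (q ^ d * M⁻¹ ^ d) := by
            rw [inv_pow]; field_simp
        _ ≤ F.card * S.card * (q ^ d * M⁻¹ ^ d) :=
            mul_le_mul_of_nonneg_right hd (by positivity)
        _ = F.card * (q ^ d * M⁻¹ ^ d) * S.card := by ring
        _ ≤ _ := mul_le_mul_of_nonneg_right key2 (by positivity)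
    exact_mod_cast h2
  exact hS ⟨q ^ d / S.card, by
    rw [mul_comm]
    exact le_antisymm hle (Nat.div_mul_le_self _ _)⟩

end NotSpectral

/-! ### Products of tiles and translation sets -/

section ProductTile

variable {d : ℕ}

theorem volume_cubeUnion_ne_zero {F : Set (Fin d → ℤ)} (hF : F.Nonempty) :
    volume (cubeUnion F) ≠ 0 := by
  obtain ⟨a, ha⟩ := hF
  have h1 : cubeUnion {a} ⊆ cubeUnion F := fun x hx => by
    have : (fun i => ⌊x i⌋) = a := hx
    show (fun i => ⌊x i⌋) ∈ F
    rwa [this]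
  have h2 := measure_mono (μ := volume) h1
  rw [volume_cubeUnion_singleton] at h2
  exact (zero_lt_one.trans_le h2).ne'

theorem cartesianProduct_cubeUnion {m n : ℕ} (F : Set (Fin m → ℤ)) (T : Set (Fin n → ℤ)) :
    cartesianProduct (cubeUnion F) (cubeUnion T) =
      cubeUnion {x | (fun i => x (Fin.castAdd n i)) ∈ F ∧ (fun j => x (Fin.natAdd m j)) ∈ T} :=
  rfl

theorem finite_append {m n : ℕ} {F : Set (Fin m → ℤ)} {T : Set (Fin n → ℤ)} (hF : F.Finite)
    (hT : T.Finite) :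
    {x : Fin (m + n) → ℤ | (fun i => x (Fin.castAdd n i)) ∈ F ∧
      (fun j => x (Fin.natAdd m j)) ∈ T}.Finite := by
  refine ((hF.prod hT).image fun p => Fin.append p.1 p.2).subset ?_
  rintro x ⟨h1, h2⟩
  exact ⟨(_, _), ⟨h1, h2⟩, Fin.append_castAdd_natAdd⟩

/-- The coordinates `((x + y) / M, y)` of a point `(x, y)` of `ℝᵈ × ℝᵈ`. -/
noncomputable def shearCoordinates (d : ℕ) {M : ℝ} (hM : M ≠ 0) :
    EuclideanSpace ℝ (Fin (d + d)) ≃ₗ[ℝ] (Fin (d + d) → ℝ) where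
  toFun z := Fin.append (fun i => (z (Fin.castAdd d i) + z (Fin.natAdd d i)) / M)
    fun i => z (Fin.natAdd d i)
  invFun w := WithLp.toLp 2 (Fin.append (fun i => M * w (Fin.castAdd d i) - w (Fin.natAdd d i))
    fun i => w (Fin.natAdd d i))
  map_add' x y := by
    ext i
    refine Fin.addCases (fun i => ?_) (fun i => ?_) i
    · simp [-Fin.natAdd_eq_addNat]; ring
    · simp [-Fin.natAdd_eq_addNat]
  map_smul' c x := by
    ext i
    refine Fin.addCases (fun i => ?_) (fun i => ?_) i
    · simp [-Fin.natAdd_eq_addNat]; ring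
    · simp [-Fin.natAdd_eq_addNat]
  left_inv z := by
    ext i
    refine Fin.addCases (fun i => ?_) (fun i => ?_) i
    · simp [-Fin.natAdd_eq_addNat]; field_simp; ring
    · simp [-Fin.natAdd_eq_addNat]
  right_inv w := by
    ext i
    refine Fin.addCases (fun i => ?_) (fun i => ?_) i
    · simp [-Fin.natAdd_eq_addNat]; field_simp
    · simp [-Fin.natAdd_eq_addNat]

/-- If `F` and `T` tile `ℤᵈ` modulo `M`, then the product of their unions of cubes is spectral. -/
theorem isSpectral_cartesianProduct_cubeUnion {F T : Set (Fin d → ℤ)} (hF : F.Finite)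
    (hT : T.Finite) (hF0 : F.Nonempty) (hT0 : T.Nonempty) {M : ℕ} (hM : 0 < M)
    (htile : ∀ x : Fin d → ℤ, ∃! p : (Fin d → ℤ) × (Fin d → ℤ),
      p.1 ∈ T ∧ (fun i => x i - p.1 i + M * p.2 i) ∈ F) :
    IsSpectral (cartesianProduct (cubeUnion F) (cubeUnion T)) := by
  rw [cartesianProduct_cubeUnion]
  refine ⟨isBounded_cubeUnion (finite_append hF hT), measurableSet_cubeUnion _,
    volume_cubeUnion_ne_zero ?_, ?_⟩
  · obtain ⟨a, ha⟩ := hF0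
    obtain ⟨b, hb⟩ := hT0
    exact ⟨Fin.append a b, by simpa using ha, by simpa [-Fin.natAdd_eq_addNat] using hb⟩
  have hM0 : (M : ℝ) ≠ 0 := by exact_mod_cast hM.ne'
  refine exists_isSpectrum_of_lattice_tile (shearCoordinates d hM0).toContinuousLinearEquiv
    (measurableSet_cubeUnion _) fun w => ?_
  set x : Fin d → ℤ := fun i => ⌊M * w (Fin.castAdd d i) - w (Fin.natAdd d i)⌋ with hx
  set y : Fin d → ℤ := fun i => ⌊w (Fin.natAdd d i)⌋ with hy
  have hmem : ∀ k : Fin (d + d) → ℤ,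
      (shearCoordinates d hM0).toContinuousLinearEquiv.symm (w + fun i => (k i : ℝ)) ∈
        cubeUnion {x | (fun i => x (Fin.castAdd d i)) ∈ F ∧ (fun j => x (Fin.natAdd d j)) ∈ T} ↔
      (fun i => x i + M * k (Fin.castAdd d i) - k (Fin.natAdd d i)) ∈ F ∧
        (fun i => y i + k (Fin.natAdd d i)) ∈ T := by
    intro k
    have h1 : ∀ i, (shearCoordinates d hM0).toContinuousLinearEquiv.symm
        (w + fun i => (k i : ℝ)) (Fin.castAdd d i) =
        (M * w (Fin.castAdd d i) - w (Fin.natAdd d i)) +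
          ((M * k (Fin.castAdd d i) - k (Fin.natAdd d i) : ℤ) : ℝ) := by
      intro i
      have : (shearCoordinates d hM0).toContinuousLinearEquiv.symm
        (w + fun i => (k i : ℝ)) (Fin.castAdd d i) = M * (w (Fin.castAdd d i) + k (Fin.castAdd d i))
          - (w (Fin.natAdd d i) + k (Fin.natAdd d i)) := by
        simp [shearCoordinates, -Fin.natAdd_eq_addNat]
      rw [this]
      push_cast
      ring
    have h2 : ∀ i, (shearCoordinates d hM0).toContinuousLinearEquiv.symm
        (w + fun i => (k i : ℝ)) (Fin.natAdd d i) =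
        w (Fin.natAdd d i) + (k (Fin.natAdd d i) : ℤ) := by
      intro i
      simp [shearCoordinates, -Fin.natAdd_eq_addNat]
    simp only [cubeUnion, Set.mem_ofPred_eq, h1, h2, Int.floor_add_intCast, hx, hy, add_sub_assoc]
  simp only [hmem]
  -- Lattice vectors bringing the point into the product correspond to tilings of x + y: the second
  -- half of k is t - y and the first half is n.
  obtain ⟨⟨t, n⟩, ⟨ht, hn⟩, huniq⟩ := htile fun i => x i + y i
  refine ⟨Fin.append n fun i => t i - y i, ⟨?_, ?_⟩, ?_⟩
  · convert hn using 2 with i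
    simp [-Fin.natAdd_eq_addNat]
    ring
  · convert ht using 1
    ext i
    simp [-Fin.natAdd_eq_addNat]
  · rintro k ⟨h1, h2⟩
    have h3 := huniq (fun i => y i + k (Fin.natAdd d i), fun i => k (Fin.castAdd d i)) ⟨h2, by
      convert h1 using 2 with i
      ring⟩
    rw [Prod.mk.injEq] at h3
    ext i
    refine Fin.addCases (fun i => ?_) (fun i => ?_) i
    · simp [← h3.2]
    · simp [← h3.1, -Fin.natAdd_eq_addNat]

/-- Addition modulo M maps the product of the box part and T onto the whole box. -/
theorem pow_le_card_boxPart_mul {𝒜 : Set (Fin d → ℤ)} {M : ℕ} (hM : 0 < M)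
    (hper : ∀ x k : Fin d → ℤ, (fun i => x i + M * k i) ∈ 𝒜 ↔ x ∈ 𝒜) (T : Finset (Fin d → ℤ))
    (hcover : ∀ x, ∃ t ∈ T, x - t ∈ 𝒜) : M ^ d ≤ (boxPart 𝒜 M).card * T.card := by
  have hM' : (0 : ℤ) < M := by exact_mod_cast hM
  have h1 : (boxPart (Set.univ : Set (Fin d → ℤ)) M).card = M ^ d := by
    simp [boxPart, Fintype.card_piFinset]
  rw [← h1, ← Finset.card_product]
  refine Finset.card_le_card_of_surjOn
    (fun p : (Fin d → ℤ) × (Fin d → ℤ) => fun i => (p.1 i + p.2 i) % M) ?_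
  intro x hx
  obtain ⟨t, ht, hxt⟩ := hcover x
  have hx' := (mem_boxPart.mp (Finset.mem_coe.mp hx)).1
  refine ⟨(fun i => (x i - t i) % M, t), ?_, ?_⟩
  · rw [Finset.mem_coe, Finset.mem_product, mem_boxPart]
    refine ⟨⟨fun i => ⟨Int.emod_nonneg _ hM'.ne', Int.emod_lt_of_pos _ hM'⟩, ?_⟩, ht⟩
    rw [← hper _ fun i => (x i - t i) / M]
    simp only [Int.emod_add_mul_ediv]
    exact hxt
  · ext i
    simp [Int.emod_eq_of_lt (hx' i).1 (hx' i).2]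

end ProductTile

/-! ### Fourier coefficients of a half arc along a linear form modulo 8 -/

section Coefficients

theorem sum_stdAddChar_pi {q d : ℕ} [NeZero q] (b : Fin d → ZMod q) :
    ∑ z : Fin d → ZMod q, (ZMod.stdAddChar (∑ i, b i * z i) : ℂ) = if b = 0 then (q : ℂ) ^ d else 0 := by
  have h1 : ∀ z : Fin d → ZMod q, (ZMod.stdAddChar (∑ i, b i * z i) : ℂ) =
      ∏ i, ZMod.stdAddChar (z i * b i) := fun z => by
    simp only [mul_comm (b _)]
    exact map_prod (ZMod.stdAddChar (N := q)).toMonoidHom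
      (fun i => Multiplicative.ofAdd (z i * b i)) Finset.univ
  simp only [h1]
  have h2 := (Finset.prod_univ_sum (fun _ : Fin d => (Finset.univ : Finset (ZMod q)))
    fun i x => (ZMod.stdAddChar (x * b i) : ℂ))
  rw [Fintype.piFinset_univ] at h2
  rw [← h2]
  simp only [AddChar.sum_mulShift _ (ZMod.isPrimitive_stdAddChar q), ZMod.card]
  by_cases hb : b = 0
  · simp [hb]
  · obtain ⟨i, hi⟩ := Function.ne_iff.mp hb
    rw [if_neg hb]
    exact Finset.prod_eq_zero (Finset.mem_univ i) (by rw [if_neg (show ¬b i = 0 from hi), Nat.cast_zero])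

/-- The indicator of C is expanded in the characters of ℤ/q; orthogonality in z keeps only those j
with jα + k = 0. -/
theorem mul_sum_stdAddChar_filter {q d : ℕ} [NeZero q] (C : Finset (ZMod q)) (α k : Fin d → ZMod q) :
    (q : ℂ) * ∑ z : Fin d → ZMod q,
        (if ∑ i, α i * z i ∈ C then (ZMod.stdAddChar (∑ i, k i * z i) : ℂ) else 0) =
      ∑ j : ZMod q, (∑ c ∈ C, (ZMod.stdAddChar (-(j * c)) : ℂ)) *
        if (fun i => j * α i + k i) = 0 then (q : ℂ) ^ d else 0 := by
  have h1 : ∀ y : ZMod q, (q : ℂ) * (if y ∈ C then 1 else 0) =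
      ∑ j : ZMod q, ∑ c ∈ C, (ZMod.stdAddChar (-(j * c)) : ℂ) * ZMod.stdAddChar (j * y) := by
    intro y
    rw [Finset.sum_comm]
    have h2 : ∀ c, ∑ j : ZMod q, (ZMod.stdAddChar (-(j * c)) : ℂ) * ZMod.stdAddChar (j * y) =
        if y = c then (q : ℂ) else 0 := by
      intro c
      have h3 := AddChar.sum_mulShift (y - c) (ZMod.isPrimitive_stdAddChar q)
      simp only [sub_eq_zero, ZMod.card] at h3
      push_cast at h3
      rw [← h3]
      refine Finset.sum_congr rfl fun j _ => ?_
      rw [← AddChar.map_add_eq_mul]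
      congr 1
      ring
    simp only [h2]
    rw [Finset.sum_ite_eq]
    split_ifs <;> simp
  have h4 : ∀ z : Fin d → ZMod q,
      (q : ℂ) * (if ∑ i, α i * z i ∈ C then (ZMod.stdAddChar (∑ i, k i * z i) : ℂ) else 0) =
      ∑ j : ZMod q, (∑ c ∈ C, (ZMod.stdAddChar (-(j * c)) : ℂ)) *
        ZMod.stdAddChar (∑ i, (j * α i + k i) * z i) := by
    intro z
    have h5 : ∀ j : ZMod q, (ZMod.stdAddChar (∑ i, (j * α i + k i) * z i) : ℂ) =
        ZMod.stdAddChar (j * ∑ i, α i * z i) * ZMod.stdAddChar (∑ i, k i * z i) := by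
      intro j
      rw [← AddChar.map_add_eq_mul, Finset.mul_sum, ← Finset.sum_add_distrib]
      congr 1
      exact Finset.sum_congr rfl fun i _ => by ring
    have h6 := congrArg (· * (ZMod.stdAddChar (∑ i, k i * z i) : ℂ)) (h1 (∑ i, α i * z i))
    simp only [mul_assoc, ite_mul, one_mul, zero_mul, Finset.sum_mul] at h6
    rw [h6]
    refine Finset.sum_congr rfl fun j _ => ?_
    rw [h5, Finset.sum_mul]
  rw [Finset.mul_sum, Finset.sum_congr rfl fun z _ => h4 z, Finset.sum_comm]
  refine Finset.sum_congr rfl fun j _ => ?_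
  rw [← Finset.mul_sum, sum_stdAddChar_pi]

/-- If ζ⁴ = 1 the sum is 4 or 0. If ζ⁴ = -1, then ζ³ is minus the conjugate of ζ and ζ² is purely
imaginary, so the real part is 1. -/
theorem re_geom_sum_four {ζ : ℂ} (hζ : ‖ζ‖ = 1) (h8 : ζ ^ 8 = 1) :
    0 ≤ (1 + ζ + ζ ^ 2 + ζ ^ 3).re ∧ (ζ = 1 ∨ ζ ^ 4 = -1 → 0 < (1 + ζ + ζ ^ 2 + ζ ^ 3).re) := by
  have hneg : ζ ^ 4 = -1 → (1 + ζ + ζ ^ 2 + ζ ^ 3).re = 1 := by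
    intro h4
    have hc : ζ * (starRingEnd ℂ) ζ = 1 := by
      rw [Complex.mul_conj, Complex.normSq_eq_norm_sq, hζ]
      simp
    have h3 : ζ ^ 3 = -(starRingEnd ℂ) ζ := by
      linear_combination (-ζ ^ 3) * hc + (starRingEnd ℂ) ζ * h4
    have h2 : ζ ^ 2 = -(starRingEnd ℂ) (ζ ^ 2) := by
      rw [map_pow]
      linear_combination (-ζ ^ 2 * (ζ * (starRingEnd ℂ) ζ + 1)) * hc + ((starRingEnd ℂ) ζ) ^ 2 * h4
    have h2' := congrArg Complex.re h2
    simp only [Complex.neg_re, Complex.conj_re] at h2'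
    have h3' := congrArg Complex.re h3
    simp only [Complex.neg_re, Complex.conj_re] at h3'
    simp only [Complex.add_re, Complex.one_re]
    linarith
  have h : (ζ ^ 4 - 1) * (ζ ^ 4 + 1) = 0 := by linear_combination h8
  rcases mul_eq_zero.mp h with h | h
  · have h' : (ζ - 1) * (1 + ζ + ζ ^ 2 + ζ ^ 3) = 0 := by linear_combination h
    rcases mul_eq_zero.mp h' with h' | h'
    · rw [sub_eq_zero] at h'
      subst h'
      norm_num
    · rw [h']
      refine ⟨le_rfl, ?_⟩
      rintro (h1 | h1)
      · subst h1
        norm_num at h'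
      · rw [h1] at h
        norm_num at h
  · have h4 : ζ ^ 4 = -1 := by linear_combination h
    rw [hneg h4]
    norm_num

/-- The first half `{0, 1, 2, 3}` of `ℤ/8`. -/
def halfArc : Finset (ZMod 8) := {0, 1, 2, 3}

theorem re_sum_halfArc (j : ZMod 8) :
    0 ≤ (∑ c ∈ halfArc, (ZMod.stdAddChar (-(j * c)) : ℂ)).re ∧
      (j = 0 ∨ 4 * j = 4 → 0 < (∑ c ∈ halfArc, (ZMod.stdAddChar (-(j * c)) : ℂ)).re) := by
  have hmul8 : ∀ j : ZMod 8, (8 : ℕ) • (-j) = 0 := by decide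
  -- In ℤ/8 the condition 4j = 4 says that j is odd; then ζ is a primitive eighth root of unity.
  have hmul4 : ∀ j : ZMod 8, 4 * j = 4 → (4 : ℕ) • (-j) = ((4 : ℤ) : ZMod 8) := by decide
  set ζ : ℂ := ZMod.stdAddChar (-j) with hζ
  have hpow : ∀ n : ℕ, (ZMod.stdAddChar (n • (-j)) : ℂ) = ζ ^ n := fun n =>
    AddChar.map_nsmul_eq_pow _ _ _
  have hsum : ∑ c ∈ halfArc, (ZMod.stdAddChar (-(j * c)) : ℂ) = 1 + ζ + ζ ^ 2 + ζ ^ 3 := by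
    rw [halfArc, Finset.sum_insert (by decide), Finset.sum_insert (by decide),
      Finset.sum_insert (by decide), Finset.sum_singleton, ← hpow 2, ← hpow 3, hζ]
    rw [show -(j * 0) = 0 by ring, show -(j * 1) = -j by ring, show -(j * 2) = 2 • (-j) by
      simp; ring, show -(j * 3) = 3 • (-j) by simp; ring, AddChar.map_zero_eq_one]
    ring
  have h8 : ζ ^ 8 = 1 := by
    rw [← hpow, hmul8, AddChar.map_zero_eq_one]
  have hnorm : ‖ζ‖ = 1 := by
    rw [hζ, ZMod.stdAddChar_apply]
    exact Circle.norm_coe _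
  have key := re_geom_sum_four hnorm h8
  rw [hsum]
  refine ⟨key.1, fun h => key.2 ?_⟩
  rcases h with h | h
  · left
    rw [hζ, h]
    simp
  · right
    rw [← hpow, hmul4 j h, ZMod.stdAddChar_coe]
    rw [show (2 * Real.pi * Complex.I * (4 : ℤ) / (8 : ℕ) : ℂ) = Real.pi * Complex.I by
      push_cast; ring]
    exact Complex.exp_pi_mul_I

theorem re_sum_stdAddChar_halfArc {d : ℕ} (α k : Fin d → ZMod 8) :
    0 ≤ (∑ z : Fin d → ZMod 8,
      (if ∑ i, α i * z i ∈ halfArc then (ZMod.stdAddChar (∑ i, k i * z i) : ℂ) else 0)).re ∧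
    ((∃ j : ZMod 8, (j = 0 ∨ 4 * j = 4) ∧ (fun i => j * α i + k i) = 0) →
      0 < (∑ z : Fin d → ZMod 8,
        (if ∑ i, α i * z i ∈ halfArc then (ZMod.stdAddChar (∑ i, k i * z i) : ℂ) else 0)).re) := by
  have h := congrArg Complex.re (mul_sum_stdAddChar_filter halfArc α k)
  rw [Complex.re_sum] at h
  set W := ∑ z : Fin d → ZMod 8,
      (if ∑ i, α i * z i ∈ halfArc then (ZMod.stdAddChar (∑ i, k i * z i) : ℂ) else 0)
  have h1 : (((8 : ℕ) : ℂ) * W).re = 8 * W.re := by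
    rw [show ((8 : ℕ) : ℂ) = ((8 : ℝ) : ℂ) by norm_num, Complex.re_ofReal_mul]
  rw [h1] at h
  have hterm : ∀ j : ZMod 8, ((∑ c ∈ halfArc, (ZMod.stdAddChar (-(j * c)) : ℂ)) *
      if (fun i => j * α i + k i) = 0 then (((8 : ℕ) : ℂ)) ^ d else 0).re =
      (∑ c ∈ halfArc, (ZMod.stdAddChar (-(j * c)) : ℂ)).re *
        if (fun i => j * α i + k i) = 0 then (8 : ℝ) ^ d else 0 := by
    intro j
    split_ifs
    · rw [show ((8 : ℕ) : ℂ) ^ d = (((8 : ℝ) ^ d : ℝ) : ℂ) by push_cast; rfl, Complex.re_mul_ofReal]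
    · simp
  simp only [hterm] at h
  have hnn : ∀ j : ZMod 8, 0 ≤ (∑ c ∈ halfArc, (ZMod.stdAddChar (-(j * c)) : ℂ)).re *
        if (fun i => j * α i + k i) = 0 then (8 : ℝ) ^ d else 0 := fun j =>
    mul_nonneg (re_sum_halfArc j).1 (by split_ifs <;> positivity)
  refine ⟨by linarith [Finset.sum_nonneg fun j (_ : j ∈ Finset.univ) => hnn j], ?_⟩
  rintro ⟨j, hj, hjk⟩
  have : 0 < ∑ j : ZMod 8, (∑ c ∈ halfArc, (ZMod.stdAddChar (-(j * c)) : ℂ)).re *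
        if (fun i => j * α i + k i) = 0 then (8 : ℝ) ^ d else 0 := by
    refine Finset.sum_pos' (fun j _ => hnn j) ⟨j, Finset.mem_univ _, ?_⟩
    rw [if_pos hjk]
    have := (re_sum_halfArc j).2 hj
    positivity
  linarith

end Coefficients

/-! ### The explicit tile -/

section NonspectralTile

open scoped Pointwise

theorem sum_boxPart_univ_add {d m : ℕ} (hm : 0 < m) (G : (Fin d → ℤ) → ℂ)
    (hG : ∀ x k : Fin d → ℤ, G (fun i => x i + m * k i) = G x) (v : Fin d → ℤ) :
    ∑ x ∈ boxPart Set.univ m, G (x + v) = ∑ x ∈ boxPart Set.univ m, G x := by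
  have hm' : (0 : ℤ) < m := by exact_mod_cast hm
  have hmod : ∀ y : Fin d → ℤ, (fun i => y i % m) ∈ boxPart (Set.univ : Set (Fin d → ℤ)) m :=
    fun y => mem_boxPart.mpr
      ⟨fun i => ⟨Int.emod_nonneg _ hm'.ne', Int.emod_lt_of_pos _ hm'⟩, trivial⟩
  refine Finset.sum_nbij' (fun x i => (x i + v i) % m) (fun x i => (x i - v i) % m)
    (fun x _ => hmod _) (fun x _ => hmod _) ?_ ?_ ?_
  · intro x hx
    have hx' := (mem_boxPart.mp hx).1
    ext i
    simp [Int.emod_eq_of_lt (hx' i).1 (hx' i).2]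
  · intro x hx
    have hx' := (mem_boxPart.mp hx).1
    ext i
    simp [Int.emod_eq_of_lt (hx' i).1 (hx' i).2]
  · intro x _
    rw [← hG (fun i => (x i + v i) % m) fun i => (x i + v i) / m]
    congr 1
    ext i
    simp only [Int.emod_add_mul_ediv, Pi.add_apply]

/-- Linear forms modulo `8`, one for each residue modulo `11`. -/
def layerForm (c : ZMod 11) : Fin 3 → ZMod 8 :=
  (![![7, 1, 0], ![1, 5, 4], ![1, 0, 0], ![7, 6, 4], ![0, 1, 0], ![6, 7, 4], ![2, 2, 4], ![2, 4, 4],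
    ![4, 2, 4], ![7, 1, 0], ![7, 1, 0]] : Fin 11 → Fin 3 → ZMod 8) c

/-- Linear forms modulo `3`, one for each residue modulo `11`. -/
def layerLabel (c : ZMod 11) : Fin 3 → ZMod 3 :=
  (![![1, 0, 0], ![0, 1, 0], ![0, 0, 1], ![2, 2, 1], ![0, 2, 1], ![2, 0, 1], ![1, 0, 0], ![0, 0, 1],
    ![0, 2, 1], ![1, 0, 0], ![1, 0, 0]] : Fin 11 → Fin 3 → ZMod 3) c

/-- A `264`-periodic subset of `ℤ³` which tiles `ℤ³` with the six translations `tileVector`. -/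
def periodicTile : Set (Fin 3 → ℤ) :=
  {x | ∑ i, layerForm (x 2) i * x i ∈ halfArc ∧ ∑ i, layerLabel (x 2) i * x i = 0}

/-- The six translations. -/
def tileVector : Fin 6 → Fin 3 → ℤ :=
  ![![0, 0, 0], ![18, 6, 55], ![4, 1, 0], ![19, 20, 44], ![23, 10, 11], ![14, 5, 55]]

/-- Six frequencies modulo `8`. -/
def frequencySet : Finset (Fin 3 → ZMod 8) :=
  {![0, 0, 0], ![2, 2, 4], ![1, 0, 0], ![0, 1, 0], ![2, 5, 4], ![5, 2, 4]}

theorem card_frequencySet : frequencySet.card = 6 := by decide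

theorem periodicTile_add_mul (x k : Fin 3 → ℤ) :
    (fun i => x i + (264 : ℕ) * k i) ∈ periodicTile ↔ x ∈ periodicTile := by
  have h8 : ((264 : ℕ) : ZMod 8) = 0 := by decide
  have h3 : ((264 : ℕ) : ZMod 3) = 0 := by decide
  have h11 : ((264 : ℕ) : ZMod 11) = 0 := by decide
  simp only [periodicTile, Set.mem_ofPred_eq, Int.cast_add, Int.cast_mul, Int.cast_natCast, h8, h3,
    h11, zero_mul, add_zero]

/-- The third coordinates of the translations are divisible by 11, so layers are preserved. Within a
layer only the values p and r of the two forms matter, which leaves 11 · 8 · 3 cases. -/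
theorem existsUnique_sub_tileVector_mem (x : Fin 3 → ℤ) :
    ∃! j : Fin 6, x - tileVector j ∈ periodicTile := by
  have h11 : ∀ j, ((tileVector j 2 : ℤ) : ZMod 11) = 0 := by decide
  have hdec : ∀ (c : ZMod 11) (p : ZMod 8) (r : ZMod 3), ∃ j : Fin 6,
      (p - ∑ i, layerForm c i * tileVector j i ∈ halfArc ∧
        r - ∑ i, layerLabel c i * tileVector j i = 0) ∧
      ∀ j' : Fin 6, (p - ∑ i, layerForm c i * tileVector j' i ∈ halfArc ∧
        r - ∑ i, layerLabel c i * tileVector j' i = 0) → j' = j := by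
    decide +kernel
  obtain ⟨j, hj, huniq⟩ := hdec (x 2) (∑ i, layerForm (x 2) i * x i) (∑ i, layerLabel (x 2) i * x i)
  have hiff : ∀ j, x - tileVector j ∈ periodicTile ↔
      (∑ i, layerForm (x 2) i * x i) - ∑ i, layerForm (x 2) i * tileVector j i ∈ halfArc ∧
        (∑ i, layerLabel (x 2) i * x i) - ∑ i, layerLabel (x 2) i * tileVector j i = 0 := by
    intro j
    simp only [periodicTile, Set.mem_ofPred_eq, Pi.sub_apply, Int.cast_sub, h11, sub_zero, mul_sub,
      Finset.sum_sub_distrib]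
  exact ⟨j, (hiff j).mpr hj, fun j' hj' => huniq j' ((hiff j').mp hj')⟩

/-- Averaging over shifts that change only residues modulo 8 turns the sum into one of half-arc
coefficients. None has a negative real part, so one positive term suffices. -/
theorem expSum_periodicTile_ne_zero (k : Fin 3 → ℤ)
    (hk : (fun i => (k i : ZMod 8)) ∈ frequencySet - frequencySet) :
    expSum (boxPart periodicTile 264) (fun i => k i / (8 : ℕ)) ≠ 0 := by
  classical
  obtain ⟨m, hm⟩ : ∃ m, 264 = m := ⟨_, rfl⟩
  have hper := periodicTile_add_mul
  rw [hm] at hper ⊢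
  set κ : Fin 3 → ZMod 8 := fun i => (k i : ZMod 8) with hκ
  -- The first nine forms represent all nonzero differences up to odd multiples. The last two layers
  -- repeat the first, making the number of layers coprime to 24.
  have hdec : ∀ s ∈ frequencySet, ∀ s' ∈ frequencySet, ∃ (c : ZMod 11) (j : ZMod 8),
      (j = 0 ∨ 4 * j = 4) ∧ (fun i => j * layerForm c i + (s - s') i) = 0 := by
    decide +kernel
  obtain ⟨c, hc⟩ : ∃ (c : ZMod 11), ∃ j : ZMod 8, (j = 0 ∨ 4 * j = 4) ∧
      (fun i => j * layerForm c i + κ i) = 0 := by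
    obtain ⟨s, hs, s', hs', h⟩ := Finset.mem_sub.mp hk
    rw [← h]
    exact hdec s hs s' hs'
  let W : (Fin 3 → ZMod 8) → ℂ := fun α => ∑ z : Fin 3 → ZMod 8,
    if ∑ i, α i * z i ∈ halfArc then (ZMod.stdAddChar (∑ i, κ i * z i) : ℂ) else 0
  let G : (Fin 3 → ℤ) → ℂ := fun x =>
    if x ∈ periodicTile then (ZMod.stdAddChar (∑ i, κ i * (x i : ZMod 8)) : ℂ) else 0
  have hexp : expSum (boxPart periodicTile m) (fun i => k i / (8 : ℕ)) =
      ∑ x ∈ boxPart Set.univ m, G x := by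
    have h1 : boxPart periodicTile m = (boxPart Set.univ m).filter (· ∈ periodicTile) := by
      ext x
      simp [mem_boxPart]
    rw [expSum, h1, Finset.sum_filter]
    refine Finset.sum_congr rfl fun x _ => ?_
    simp only [G]
    refine if_congr Iff.rfl ?_ rfl
    have h2 : (∑ i, κ i * (x i : ZMod 8)) = ((∑ i, k i * x i : ℤ) : ZMod 8) := by
      simp [hκ]
    rw [h2, ZMod.stdAddChar_coe, Real.fourierChar_apply]
    congr 1
    push_cast
    simp only [Finset.mul_sum, Finset.sum_div, Finset.sum_mul]
    exact Finset.sum_congr rfl fun i _ => by ring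
  have hG : ∀ x k : Fin 3 → ℤ, G (fun i => x i + m * k i) = G x := by
    intro x k
    have h8 : (m : ZMod 8) = 0 := by rw [← hm]; decide
    simp only [G, hper, Int.cast_add, Int.cast_mul, Int.cast_natCast, h8, zero_mul,
      add_zero]
  have hlayer : ∀ x : Fin 3 → ℤ,
      ∑ u : Fin 3 → ZMod 8, G (x + fun i => 33 * ((u i).val : ℤ)) =
        if ∑ i, layerLabel (x 2) i * (x i : ZMod 3) = 0 then W (layerForm (x 2)) else 0 := by
    intro x
    -- A shift by 33u acts as u modulo 8 and fixes both the layer and the label modulo 3.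
    have h8 : (33 : ZMod 8) = 1 := by decide
    have h3 : (33 : ZMod 3) = 0 := by decide
    have h11 : (33 : ZMod 11) = 0 := by decide
    have hcast : ∀ (u : Fin 3 → ZMod 8) (i : Fin 3),
        (((x + fun i => 33 * ((u i).val : ℤ)) i : ℤ) : ZMod 8) = x i + u i := by
      intro u i
      simp [h8]
    have hcast3 : ∀ (u : Fin 3 → ZMod 8) (i : Fin 3),
        (((x + fun i => 33 * ((u i).val : ℤ)) i : ℤ) : ZMod 3) = x i := by
      intro u i
      simp [h3]
    have hcast11 : ∀ (u : Fin 3 → ZMod 8) (i : Fin 3),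
        (((x + fun i => 33 * ((u i).val : ℤ)) i : ℤ) : ZMod 11) = x i := by
      intro u i
      simp [h11]
    simp only [G, periodicTile, Set.mem_ofPred_eq, hcast, hcast3, hcast11]
    by_cases hx : ∑ i, layerLabel (x 2) i * (x i : ZMod 3) = 0
    · simp only [hx, and_true, if_true, W]
      exact Fintype.sum_equiv (Equiv.addLeft fun i => (x i : ZMod 8)) _ _ fun u => rfl
    · simp [hx]
  have havg : ∑ _u : Fin 3 → ZMod 8, ∑ x ∈ boxPart Set.univ m, G x =
      ∑ x ∈ boxPart Set.univ m,
        if ∑ i, layerLabel (x 2) i * (x i : ZMod 3) = 0 then W (layerForm (x 2)) else 0 := by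
    rw [← Finset.sum_congr rfl fun x _ => hlayer x]
    refine Eq.trans ?_ Finset.sum_comm
    have hshift := sum_boxPart_univ_add (m := m) (by omega) G hG
    exact Finset.sum_congr rfl fun u _ => (hshift _).symm
  have hpos : 0 < (∑ x ∈ boxPart Set.univ m,
      if ∑ i, layerLabel (x 2) i * (x i : ZMod 3) = 0 then W (layerForm (x 2)) else 0).re := by
    rw [Complex.re_sum]
    -- As 12 is 1 modulo 11 and 0 modulo 3, this point lies in layer c and satisfies the label
    -- condition.
    refine Finset.sum_pos' (fun x _ => ?_) ⟨![0, 0, 12 * (c.val : ℤ)], ?_, ?_⟩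
    · split_ifs
      · exact (re_sum_stdAddChar_halfArc _ κ).1
      · simp
    · rw [mem_boxPart]
      have hlt := ZMod.val_lt c
      refine ⟨fun i => ?_, trivial⟩
      fin_cases i <;> simp [-ZMod.natCast_val] <;> omega
    · have h3 : (12 : ZMod 3) = 0 := by decide
      have h11 : (12 : ZMod 11) = 1 := by decide
      simp only [Fin.sum_univ_three]
      simp [h3, h11]
      exact (re_sum_stdAddChar_halfArc _ κ).2 hc
  intro h0
  rw [← havg, ← hexp, h0] at hpos
  simp at hpos

end NonspectralTile

/-! ### The counterexample -/

theorem theorem1 :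
    ∃ A B : Set (EuclideanSpace ℝ (Fin 3)),
      (Bornology.IsBounded A ∧ MeasurableSet A ∧ volume A ≠ 0) ∧
      (Bornology.IsBounded B ∧ MeasurableSet B ∧ volume B ≠ 0) ∧
      ¬ IsSpectral A ∧
      IsSpectral (cartesianProduct A B : Set (EuclideanSpace ℝ (Fin 6))) := by
  let T : Finset (Fin 3 → ℤ) := Finset.univ.image tileVector
  have hinj : Function.Injective tileVector := by decide
  have hT : T.card = 6 := by rw [Finset.card_image_of_injective _ hinj]; rfl
  have hper : ∀ (N : ℕ) (x k : Fin 3 → ℤ),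
      (fun i => x i + (264 * N : ℕ) * k i) ∈ periodicTile ↔ x ∈ periodicTile := by
    intro N x k
    rw [← periodicTile_add_mul x fun i => N * k i]
    push_cast
    simp only [mul_assoc]
  have hcover : ∀ x, ∃ t ∈ T, x - t ∈ periodicTile := fun x => by
    obtain ⟨j, hj, -⟩ := existsUnique_sub_tileVector_mem x
    exact ⟨_, Finset.mem_image_of_mem _ (Finset.mem_univ j), hj⟩
  have hdens : ∀ N, (264 * N) ^ 3 ≤ (boxPart periodicTile (264 * N)).card * frequencySet.card := by
    intro N
    rw [card_frequencySet, ← hT]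
    rcases Nat.eq_zero_or_pos N with rfl | hN
    · simp
    · exact pow_le_card_boxPart_mul (by positivity) (hper N) T hcover
  obtain ⟨N, hN, hspec⟩ := exists_not_isSpectrum_cubeUnion (q := 8) (by norm_num) (by norm_num)
    periodicTile_add_mul frequencySet (by rw [card_frequencySet]; norm_num) hdens
    expSum_periodicTile_ne_zero
  set F := boxPart periodicTile (264 * N) with hF
  have hF0 : F.Nonempty := by
    rw [← Finset.card_pos]
    exact Nat.pos_of_mul_pos_right (lt_of_lt_of_le (by positivity) (hdens N))
  have hT0 : T.Nonempty := by rw [← Finset.card_pos, hT]; norm_num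
  refine ⟨cubeUnion F, cubeUnion T,
    ⟨isBounded_cubeUnion F.finite_toSet, measurableSet_cubeUnion _, volume_cubeUnion_ne_zero hF0⟩,
    ⟨isBounded_cubeUnion T.finite_toSet, measurableSet_cubeUnion _, volume_cubeUnion_ne_zero hT0⟩,
    fun h => h.2.2.2.elim hspec,
    isSpectral_cartesianProduct_cubeUnion F.finite_toSet T.finite_toSet hF0 hT0
      (M := 264 * N) (by positivity) fun x => ?_⟩
  have hM : (0 : ℤ) < (264 * N : ℕ) := by positivity
  obtain ⟨j, hj, hjuniq⟩ := existsUnique_sub_tileVector_mem x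
  -- The lattice vector reduces x - t into the box; periodicity keeps the reduced point in the tile.
  refine ⟨(tileVector j, fun i => -((x i - tileVector j i) / (264 * N : ℕ))), ⟨?_, ?_⟩, ?_⟩
  · exact Finset.mem_coe.mpr (Finset.mem_image_of_mem _ (Finset.mem_univ j))
  · rw [Finset.mem_coe, mem_boxPart]
    refine ⟨fun i => ?_, (hper N _ _).mpr hj⟩
    have h1 : x i - tileVector j i + (264 * N : ℕ) * -((x i - tileVector j i) / (264 * N : ℕ)) =
        (x i - tileVector j i) % (264 * N : ℕ) := by
      rw [Int.emod_def]
      ring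
    simp only [h1]
    exact ⟨Int.emod_nonneg _ hM.ne', Int.emod_lt_of_pos _ hM⟩
  · rintro ⟨t, n⟩ ⟨ht, hn⟩
    obtain ⟨j', -, rfl⟩ := Finset.mem_image.mp (Finset.mem_coe.mp ht)
    rw [Finset.mem_coe, mem_boxPart] at hn
    obtain ⟨hbox, hmem⟩ := hn
    have hj' : j' = j := hjuniq j' ((hper N _ n).mp hmem)
    subst hj'
    refine Prod.ext rfl (funext fun i => ?_)
    have h1 := hbox i
    simp only at h1 ⊢
    have h2 : (x i - tileVector j' i + (264 * N : ℕ) * n i) / (264 * N : ℕ) = 0 :=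
      Int.ediv_eq_zero_of_lt h1.1 h1.2
    rw [Int.add_mul_ediv_left _ _ hM.ne'] at h2
    linarith
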